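/- **Theorem 8.2 (The Geometric Restriction Theorem).** Let $Z$ be a smooth Riemannian manifold and let $G(p,TZ)\to Z$ be the bundle of tangent $p$-planes of $Z$. Let $\mathbf{G}\subset G(p,TZ)$ be a closed subset that admits a smooth neighborhood retraction preserving the fibres of $G(p,TZ)\to Z$; that is, there are an open set $N\supset\mathbf{G}$ and a smooth map $\rho:N\to G(p,TZ)$ over the identity of $Z$ with $\rho(N)\subset\mathbf{G}$ and $\rho|_{\mathbf{G}}=\mathrm{id}$. An upper semi-continuous function $u:Z\to[-\infty,\infty)$ is called *$\mathbf{G}$-plurisubharmonic* if for every $z\in Z$, every function $\varphi$ which is $C^2$ near $z$ with $u\le\varphi$ near $z$ and $u(z)=\varphi(z)$, and every $\xi\in\mathbf{G}$ at $z$, $$\operatorname{trace}\{\operatorname{Hess}_z\varphi\,|_\xi\}\ \ge\ 0,$$ where $\operatorname{Hess}$ is the Riemannian Hessian. Let $X\subset Z$ be a (possibly only immersed) smooth submanifold of dimension $\ge p$ with the induced metric, let $\mathbf{G}(TX)=\{\xi\in\mathbf{G}:\xi\subset TX\}\subset G(p,TX)$, and let $B_{V,W}=(\nabla_V\widetilde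 W)^N$ be the second fundamental form of $X$. Suppose that $X$ is *$\mathbf{G}$-flat*, i.e. 1. ($\mathbf{G}$-regularity) each $\xi\in\mathbf{G}(TX)$ at a point $x\in X$ extends to a smooth field of planes belonging to $\mathbf{G}(TX)$ on a neighborhood of $x$ in $X$; and 2. $\operatorname{trace}\{B|_\xi\}=0$ for all $\xi\in\mathbf{G}(TX)$. Then for every $\mathbf{G}$-plurisubharmonic function $u$ on $Z$, the restriction $u|_X$ is $\mathbf{G}(TX)$-plurisubharmonic on $X$: it is an upper semi-continuous function with values in $[-\infty,\infty)$, and for every $x\in X$, every function $\varphi$ on $X$ which is $C^2$ near $x$ with $u|_X\le\varphi$ near $x$ and $u(x)=\varphi(x)$, and every $\xi\in\mathbf{G}(TX)$ at $x$, one has $\operatorname{trace}\{(\operatorname{Hess}_X\varphi)_x|_\xi\}\ge 0$, where $\operatorname{Hess}_X$ is the Riemannian Hessian of the induced metric on $X$. -/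

import Mathlib

open Bundle Manifold Module Topology
open scoped Manifold ContDiff

noncomputable section

namespace GeometricRestriction

variable {E : Type*} [NormedAddCommGroup E] [NormedSpace ℝ E]
  {Z : Type*} [TopologicalSpace Z] [ChartedSpace E Z]
  {F : Type*} [NormedAddCommGroup F] [NormedSpace ℝ F]
  {X : Type*} [TopologicalSpace X] [ChartedSpace F X]

/-! ### Metrics, Christoffel symbols, Hessian, second fundamental form -/

variable (E Z) in
/-- A field of bilinear forms on the tangent spaces of `Z`. The Riemannian metrics below are
of this kind: the given metric of the ambient manifold, and the metric induced on a submanifold. -/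
abbrev BilinearField : Type _ :=
  ∀ z : Z, TangentSpace 𝓘(ℝ, E) z →L[ℝ] TangentSpace 𝓘(ℝ, E) z →L[ℝ] ℝ

/-- The differential of `f : X → Z` at `x`. -/
abbrev differential (f : X → Z) (x : X) :
    TangentSpace 𝓘(ℝ, F) x →L[ℝ] TangentSpace 𝓘(ℝ, E) (f x) :=
  mfderiv 𝓘(ℝ, F) 𝓘(ℝ, E) f x

/-- The pull-back `f^* g`, that is, `(f^* g)_x(v, w) = g_{f x}(df v, df w)`. If `f` is the inclusion
of a submanifold and `g` a Riemannian metric, this is the induced Riemannian metric. -/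
def pullbackMetric (f : X → Z) (g : BilinearField E Z) : BilinearField F X := fun x =>
  ContinuousLinearMap.bilinearComp (E := E) (F := E) (E' := F) (F' := F)
    (g (f x)) (differential f x) (differential f x)

/-- The expression, in the preferred chart `ψ` around `z`, of a field of bilinear forms on `Z`:
at the point `y` of the model space it is `(v, w) ↦ g(d(ψ⁻¹)_y v, d(ψ⁻¹)_y w)`. -/
def coordMetric (g : BilinearField E Z) (z : Z) (y : E) : E →L[ℝ] E →L[ℝ] ℝ :=
  pullbackMetric (F := E) (X := E) (extChartAt 𝓘(ℝ, E) z).symm g y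

/-- The Christoffel symbols `Γ_y(v, w) = ∑ Γ^k_{ij} v^i w^j ∂_k` of a metric `h` on an open subset
of the model space: `Γ_y(v, w)` is the vector with
`2 h_y(Γ_y(v, w), a) = (∂_v h)(w, a) + (∂_w h)(v, a) - (∂_a h)(v, w)` for all `a`. -/
def christoffel (h : E → E →L[ℝ] E →L[ℝ] ℝ) (y v w : E) : E :=
  (h y).inverse ((1 / 2 : ℝ) •
    (fderiv ℝ h y v w + fderiv ℝ h y w v - ((fderiv ℝ h y).flip v).flip w))

/-- The Riemannian Hessian `Hess φ (v, w)` at `z`, computed in the preferred chart around `z` as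
`∂_v ∂_w φ - dφ(Γ(v, w))`. -/
def hessian (g : BilinearField E Z) (φ : Z → ℝ) (z : Z) (v w : TangentSpace 𝓘(ℝ, E) z) : ℝ :=
  let ψ := extChartAt 𝓘(ℝ, E) z
  let φ' : E → ℝ := φ ∘ ψ.symm
  let v' : E := differential (F := E) (E := E) (Z := E) ψ z v
  let w' : E := differential (F := E) (E := E) (Z := E) ψ z w
  fderiv ℝ (fderiv ℝ φ') (ψ z) v' w' -
    fderiv ℝ φ' (ψ z) (christoffel (coordMetric g z) (ψ z) v' w')

/-- The component of `a ∈ T_{f x} Z` tangent to the submanifold `f : X → Z`: it is `df(t)`, where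
`t ∈ T_x X` satisfies `g(df t, df s) = g(a, df s)` for all `s ∈ T_x X`. -/
def tangentialPart (g : BilinearField E Z) (f : X → Z) (x : X)
    (a : TangentSpace 𝓘(ℝ, E) (f x)) : TangentSpace 𝓘(ℝ, E) (f x) :=
  differential (F := F) f x
    ((pullbackMetric (F := F) f g x).inverse ((g (f x) a).comp (differential (F := F) f x)))

/-- The component of `a ∈ T_{f x} Z` normal to the submanifold `f : X → Z`. -/
def normalPart (g : BilinearField E Z) (f : X → Z) (x : X)
    (a : TangentSpace 𝓘(ℝ, E) (f x)) : TangentSpace 𝓘(ℝ, E) (f x) :=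
  a - tangentialPart (F := F) g f x a

/-- The covariant derivative `∇_v W̃`, for the Levi-Civita connection of `g` on `Z`, of the vector
field `W̃` tangent to the submanifold `f : X → Z` that extends `w ∈ T_x X` with constant
components in the preferred chart of `X` around `x`. If `c : F → E` is the expression of `f` in the
preferred charts, this field is `∂_w c`, and its covariant derivative is
`∂_v ∂_w c + Γ(∂_v c, ∂_w c)`. -/
def covDerivExtension (g : BilinearField E Z) (f : X → Z) (x : X)
    (v w : TangentSpace 𝓘(ℝ, F) x) : TangentSpace 𝓘(ℝ, E) (f x) :=
  let ψX := extChartAt 𝓘(ℝ, F) x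
  let ψZ := extChartAt 𝓘(ℝ, E) (f x)
  let c : F → E := ψZ ∘ f ∘ ψX.symm
  let v' : F := differential (F := F) (E := F) (Z := F) ψX x v
  let w' : F := differential (F := F) (E := F) (Z := F) ψX x w
  let a : E := fderiv ℝ (fderiv ℝ c) (ψX x) v' w' +
    christoffel (coordMetric g (f x)) (ψZ (f x))
      (fderiv ℝ c (ψX x) v') (fderiv ℝ c (ψX x) w')
  (mfderiv 𝓘(ℝ, E) 𝓘(ℝ, E) ψZ.symm (ψZ (f x)) : E →L[ℝ] E) a

/-- The second fundamental form `B_{v, w} = (∇_v W̃)^N` of the submanifold `f : X → Z`. -/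
def secondFundamentalForm (g : BilinearField E Z) (f : X → Z) (x : X)
    (v w : TangentSpace 𝓘(ℝ, F) x) : TangentSpace 𝓘(ℝ, E) (f x) :=
  normalPart (F := F) g f x (covDerivExtension (F := F) g f x v w)

/-! ### The Grassmann bundle of tangent `p`-planes -/

variable (E Z) in
/-- A tangent `p`-plane of `Z`, i.e. a point of the Grassmann bundle `G(p, TZ)`. -/
structure TangentPlane (p : ℕ) where
  /-- the foot point -/
  base : Z
  /-- the `p`-dimensional subspace of the tangent space -/
  plane : Submodule ℝ (TangentSpace 𝓘(ℝ, E) base)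
  finrank_eq : finrank ℝ plane = p

variable (E Z) in
/-- The vector bundle `Hom(ℝᵖ, TZ)`, i.e. the `p`-fold direct sum of `TZ`; its point `(z, A)`
is the `p`-tuple of tangent vectors `A e₁, …, A e_p` at `z`. -/
abbrev Tuples (p : ℕ) : Type _ :=
  TotalSpace (EuclideanSpace ℝ (Fin p) →L[ℝ] E)
    (fun z : Z => Bundle.Trivial Z (EuclideanSpace ℝ (Fin p)) z →L[ℝ] TangentSpace 𝓘(ℝ, E) z)

/-- A `p`-tuple of tangent vectors is a frame if it is linearly independent. -/
def IsFrame {p : ℕ} (A : Tuples E Z p) : Prop := Function.Injective A.2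

/-- The `p`-plane spanned by a frame. -/
def planeOf {p : ℕ} (A : {A : Tuples E Z p // IsFrame A}) : TangentPlane E Z p where
  base := A.1.1
  plane := LinearMap.range A.1.2.toLinearMap
  finrank_eq := by
    refine (LinearMap.finrank_range_of_inj (f := A.1.2.toLinearMap) A.2).trans ?_
    exact finrank_euclideanSpace_fin

/-- `A` is a frame of the `p`-plane `ξ`. -/
def IsFrameOf {p : ℕ} (A : Tuples E Z p) (ξ : TangentPlane E Z p) : Prop :=
  ∃ h : IsFrame A, planeOf ⟨A, h⟩ = ξ

variable [IsManifold 𝓘(ℝ, E) ∞ Z] [IsManifold 𝓘(ℝ, F) ∞ X]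

/-- The topology of `G(p, TZ)`: the quotient topology from the open set of frames in the
total space of `Hom(ℝᵖ, TZ)`. -/
instance {p : ℕ} : TopologicalSpace (TangentPlane E Z p) :=
  TopologicalSpace.coinduced (planeOf (E := E) (Z := Z) (p := p)) inferInstance

/-- A field `η` of tangent `p`-planes of `X` is smooth at `x` if it has a smooth frame near `x`. -/
def SmoothPlaneFieldAt {p : ℕ} (η : X → TangentPlane F X p) (x : X) : Prop :=
  ∃ A : X → Tuples F X p,
    ContMDiffAt 𝓘(ℝ, F) (𝓘(ℝ, F).prod 𝓘(ℝ, EuclideanSpace ℝ (Fin p) →L[ℝ] F)) ∞ A x ∧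
    ∀ᶠ x' in 𝓝 x, IsFrameOf (A x') (η x')

/-- A map `ρ` from `G(p, TZ)` to itself is smooth at `ξ`, for the smooth structure of `G(p, TZ)` as
the quotient of the bundle of frames by `GL_p`: around each frame of `ξ`, the map `ρ` lifts to a
smooth map of frames. -/
def SmoothGrassmannMapAt {p : ℕ} (ρ : TangentPlane E Z p → TangentPlane E Z p)
    (ξ : TangentPlane E Z p) : Prop :=
  ∀ A : Tuples E Z p, IsFrameOf A ξ → ∃ R : Tuples E Z p → Tuples E Z p,
    ContMDiffAt (𝓘(ℝ, E).prod 𝓘(ℝ, EuclideanSpace ℝ (Fin p) →L[ℝ] E))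
      (𝓘(ℝ, E).prod 𝓘(ℝ, EuclideanSpace ℝ (Fin p) →L[ℝ] E)) ∞ R A ∧
    ∀ᶠ A' in 𝓝 A, ∀ ξ', IsFrameOf A' ξ' → IsFrameOf (R A') (ρ ξ')

/-- `𝒢 ⊆ G(p, TZ)` admits a smooth neighbourhood retraction that preserves the fibres of
`G(p, TZ) → Z`. -/
def HasSmoothFibrewiseRetraction {p : ℕ} (𝒢 : Set (TangentPlane E Z p)) : Prop :=
  ∃ (N : Set (TangentPlane E Z p)) (ρ : TangentPlane E Z p → TangentPlane E Z p),
    IsOpen N ∧ 𝒢 ⊆ N ∧ (∀ ξ ∈ N, ρ ξ ∈ 𝒢) ∧ (∀ ξ ∈ 𝒢, ρ ξ = ξ) ∧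
    (∀ ξ ∈ N, (ρ ξ).base = ξ.base) ∧ ∀ ξ ∈ N, SmoothGrassmannMapAt ρ ξ

/-! ### Plurisubharmonic functions -/

/-- `e` is an orthonormal basis, for the metric `g`, of the plane `ξ`. -/
def IsOrthonormalBasisOf {p : ℕ} (g : BilinearField E Z) (ξ : TangentPlane E Z p)
    (e : Fin p → TangentSpace 𝓘(ℝ, E) ξ.base) : Prop :=
  (∀ j k, g ξ.base (e j) (e k) = if j = k then 1 else 0) ∧
    Submodule.span ℝ (Set.range e) = ξ.plane

/-- `φ` is a test function for `u` at `z`: it is `C²` near `z`, `u ≤ φ` near `z`, and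
`u(z) = φ(z)`. -/
def IsTestFunction (u : Z → EReal) (z : Z) (φ : Z → ℝ) : Prop :=
  ContMDiffAt 𝓘(ℝ, E) 𝓘(ℝ, ℝ) 2 φ z ∧ (∀ᶠ z' in 𝓝 z, u z' ≤ (φ z' : EReal)) ∧
    u z = (φ z : EReal)

/-- `u : Z → [-∞, ∞)` is upper semi-continuous and `𝒢`-plurisubharmonic: every test function `φ`
for `u` at a point satisfies `trace (Hess φ|_ξ) ≥ 0` for every `ξ ∈ 𝒢` at that point, the trace being
computed in an orthonormal basis of `ξ`. -/
def IsPlurisubharmonic {p : ℕ} (g : BilinearField E Z) (𝒢 : Set (TangentPlane E Z p))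
    (u : Z → EReal) : Prop :=
  UpperSemicontinuous u ∧ (∀ z, u z ≠ ⊤) ∧
    ∀ ξ ∈ 𝒢, ∀ φ : Z → ℝ, IsTestFunction (E := E) u ξ.base φ →
      ∀ e, IsOrthonormalBasisOf g ξ e → 0 ≤ ∑ j, hessian g φ ξ.base (e j) (e j)

/-! ### Flat submanifolds -/

/-- `𝒢(TX)`: the tangent `p`-planes of the submanifold `f : X → Z` that are `𝒢`-planes of `Z`. -/
def tangentPlanes {p : ℕ} (f : X → Z) (𝒢 : Set (TangentPlane E Z p)) :
    Set (TangentPlane F X p) :=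
  {η | ∃ ξ ∈ 𝒢, ∃ h, (⟨f η.base, η.plane.map (differential f η.base).toLinearMap, h⟩ :
    TangentPlane E Z p) = ξ}

/-- `X` is `𝒢`-regular: each `η₀ ∈ 𝒢(TX)` extends to a smooth field of planes in `𝒢(TX)` on a
neighbourhood, in `X`, of its foot point. -/
def IsRegular {p : ℕ} (f : X → Z) (𝒢 : Set (TangentPlane E Z p)) : Prop :=
  ∀ η₀ ∈ tangentPlanes (F := F) f 𝒢, ∃ (U : Set X) (η : X → TangentPlane F X p),
    IsOpen U ∧ η₀.base ∈ U ∧ η η₀.base = η₀ ∧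
    ∀ x ∈ U, (η x).base = x ∧ η x ∈ tangentPlanes f 𝒢 ∧ SmoothPlaneFieldAt η x

/-- `X` is `𝒢`-flat: it is `𝒢`-regular, and `trace (B|_η) = 0` for all `η ∈ 𝒢(TX)`. -/
def IsFlat {p : ℕ} (g : BilinearField E Z) (f : X → Z) (𝒢 : Set (TangentPlane E Z p)) : Prop :=
  IsRegular (F := F) f 𝒢 ∧
    ∀ η ∈ tangentPlanes (F := F) f 𝒢, ∀ e, IsOrthonormalBasisOf (pullbackMetric f g) η e →
      ∑ j, secondFundamentalForm g f η.base (e j) (e j) = 0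

end GeometricRestriction

end

/-
In charts in which `X` is a linear subspace `S` of `E`, the retraction extends a field of planes of
`𝒢(TX)` along `X` to a field of planes of `𝒢` on a neighbourhood in `Z`, and the extended function
`u` satisfies the viscosity inequality for the Hessian trace over these planes. Let `f` be a strict
test function for `u` on `S`, extended to `E`. The maxima of `u - f - n |P|²`, where `P` is a linear
map with kernel `S`, converge to the point of contact as `n → ∞`, and `n |P|² → 0` along them.
There the Hessian trace of `f + n |P|²` is nonnegative. Flatness makes the Hessian trace of the
components of `P` vanish on `S`, and the planes are tangent to `S` along `S`, so the Hessian trace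
of `|P|²` is `O(|P|²)`: the contribution of the penalty tends to `0`, and the Hessian trace of `f`
is nonnegative at the point of contact. By flatness again it is the trace of the intrinsic Hessian.
-/

noncomputable section

set_option maxSynthPendingDepth 3

namespace GeometricRestriction

section LocalHessian

variable {E : Type*} [NormedAddCommGroup E] [NormedSpace ℝ E]
  {F : Type*} [NormedAddCommGroup F] [NormedSpace ℝ F]

/-- The Christoffel symbols `christoffel h y`, bundled as a continuous bilinear map. -/
def christoffelForm (h : E → E →L[ℝ] E →L[ℝ] ℝ) (y : E) : E →L[ℝ] E →L[ℝ] E :=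
  ContinuousLinearMap.compL ℝ E (E →L[ℝ] ℝ) E (h y).inverse ∘L ((1 / 2 : ℝ) •
    (fderiv ℝ h y + (fderiv ℝ h y).flip -
      (ContinuousLinearMap.flipₗᵢ ℝ E E ℝ : (E →L[ℝ] E →L[ℝ] ℝ) →L[ℝ] E →L[ℝ] E →L[ℝ] ℝ) ∘L
        (fderiv ℝ h y).flip))

theorem christoffelForm_apply (h : E → E →L[ℝ] E →L[ℝ] ℝ) (y v w : E) :
    christoffelForm h y v w = christoffel h y v w := by
  simp [christoffelForm, christoffel]

/-- The Hessian `∂_v ∂_w f - df(Γ(v, w))` of a function on an open subset of a vector space, for a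
metric `h` there. -/
def localHessian (h : E → E →L[ℝ] E →L[ℝ] ℝ) (f : E → ℝ) (y : E) : E →L[ℝ] E →L[ℝ] ℝ :=
  fderiv ℝ (fderiv ℝ f) y -
    ContinuousLinearMap.compL ℝ E E ℝ (fderiv ℝ f y) ∘L christoffelForm h y

theorem localHessian_apply (h : E → E →L[ℝ] E →L[ℝ] ℝ) (f : E → ℝ) (y v w : E) :
    localHessian h f y v w =
      fderiv ℝ (fderiv ℝ f) y v w - fderiv ℝ f y (christoffel h y v w) := by
  simp [localHessian, christoffelForm_apply]

theorem localHessian_congr {h : E → E →L[ℝ] E →L[ℝ] ℝ} {f f' : E → ℝ} {y : E}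
    (hf : f =ᶠ[𝓝 y] f') : localHessian h f y = localHessian h f' y := by
  simp only [localHessian, hf.fderiv_eq, hf.fderiv.fderiv_eq]

theorem localHessian_add (h : E → E →L[ℝ] E →L[ℝ] ℝ) {f f' : E → ℝ} {y : E}
    (hf : ContDiffAt ℝ 2 f y) (hf' : ContDiffAt ℝ 2 f' y) :
    localHessian h (f + f') y = localHessian h f y + localHessian h f' y := by
  have hadd : fderiv ℝ (f + f') =ᶠ[𝓝 y] fderiv ℝ f + fderiv ℝ f' := by
    filter_upwards [hf.eventually (by simp), hf'.eventually (by simp)] with z hz hz'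
    exact fderiv_add (hz.differentiableAt two_ne_zero) (hz'.differentiableAt two_ne_zero)
  have hdiff {k : E → ℝ} (hk : ContDiffAt ℝ 2 k y) : DifferentiableAt ℝ (fderiv ℝ k) y :=
    (hk.fderiv_right (m := 1) le_rfl).differentiableAt one_ne_zero
  ext v w
  simp only [localHessian_apply, add_apply, hadd.fderiv_eq, hadd.eq_of_nhds, Pi.add_apply,
    fderiv_add (hdiff hf) (hdiff hf')]
  ring

theorem localHessian_const_smul (h : E → E →L[ℝ] E →L[ℝ] ℝ) (a : ℝ) (f : E → ℝ) (y : E) :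
    localHessian h (a • f) y = a • localHessian h f y := by
  have hsmul' : fderiv ℝ (a • fderiv ℝ f) = a • fderiv ℝ (fderiv ℝ f) := fderiv_const_smul_field a
  ext v w
  simp [localHessian_apply, fderiv_const_smul_field, hsmul', mul_sub]

theorem localHessian_add_const (h : E → E →L[ℝ] E →L[ℝ] ℝ) (f : E → ℝ) (a : ℝ) (y : E) :
    localHessian h (fun z => f z + a) y = localHessian h f y := by
  have hadd : fderiv ℝ (fun z => f z + a) = fderiv ℝ f := funext fun z => fderiv_add_const a
  simp only [localHessian, hadd]

theorem contDiffAt_christoffelForm [CompleteSpace E] {h : E → E →L[ℝ] E →L[ℝ] ℝ} {y : E}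
    {n : ℕ∞} (hh : ContDiffAt ℝ (n + 1) h y) (hy : (h y).IsInvertible) :
    ContDiffAt ℝ n (christoffelForm h) y := by
  have hinv : ContDiffAt ℝ n (fun z => (h z).inverse) y :=
    hy.contDiffAt_map_inverse.comp y (hh.of_le le_self_add)
  have hD : ContDiffAt ℝ n (fderiv ℝ h) y := hh.fderiv_right le_rfl
  have hflip : ContDiffAt ℝ n (fun z => (fderiv ℝ h z).flip) y :=
    (ContinuousLinearMap.flipₗᵢ ℝ E E (E →L[ℝ] ℝ)).contDiff.contDiffAt.comp y hD
  have hflip' : ContDiffAt ℝ n (fun z => ((ContinuousLinearMap.flipₗᵢ ℝ E E ℝ :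
      (E →L[ℝ] E →L[ℝ] ℝ) →L[ℝ] E →L[ℝ] E →L[ℝ] ℝ) ∘L (fderiv ℝ h z).flip)) y :=
    contDiffAt_const.clm_comp hflip
  have hcomp : ContDiffAt ℝ n (fun z =>
      ContinuousLinearMap.compL ℝ E (E →L[ℝ] ℝ) E (h z).inverse) y :=
    (ContinuousLinearMap.compL ℝ E (E →L[ℝ] ℝ) E).contDiff.contDiffAt.comp y hinv
  have hsum : ContDiffAt ℝ n (fun z => fderiv ℝ h z + (fderiv ℝ h z).flip) y := hD.add hflip
  have hdiff := hsum.sub hflip'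
  exact hcomp.clm_comp (hdiff.const_smul (1 / 2 : ℝ))

theorem contDiffAt_localHessian [CompleteSpace E] {h : E → E →L[ℝ] E →L[ℝ] ℝ} {f : E → ℝ} {y : E}
    {n : ℕ∞} (hh : ContDiffAt ℝ (n + 1) h y) (hy : (h y).IsInvertible)
    (hf : ContDiffAt ℝ (n + 2) f y) : ContDiffAt ℝ n (localHessian h f) y := by
  have hf' : ContDiffAt ℝ (n + 1) (fderiv ℝ f) y :=
    hf.fderiv_right (by rw [add_assoc, one_add_one_eq_two])
  exact (hf'.fderiv_right le_rfl).sub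
    (((ContinuousLinearMap.compL ℝ E E ℝ).contDiff.contDiffAt.comp y
      (hf'.of_le le_self_add)).clm_comp (contDiffAt_christoffelForm hh hy))

theorem fderiv_fderiv_comp {c : F → E} {f : E → ℝ} {a : F} (hc : ContDiffAt ℝ 2 c a)
    (hf : ContDiffAt ℝ 2 f (c a)) (v w : F) :
    fderiv ℝ (fderiv ℝ (f ∘ c)) a v w =
      fderiv ℝ (fderiv ℝ f) (c a) (fderiv ℝ c a v) (fderiv ℝ c a w) +
        fderiv ℝ f (c a) (fderiv ℝ (fderiv ℝ c) a v w) := by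
  have hcomp : fderiv ℝ (f ∘ c) =ᶠ[𝓝 a] fun y => (fderiv ℝ f (c y)).comp (fderiv ℝ c y) := by
    filter_upwards [hc.eventually (by simp),
      hc.continuousAt.eventually (hf.eventually (by simp))] with y hy hfy
    exact fderiv_comp y (hfy.differentiableAt two_ne_zero) (hy.differentiableAt two_ne_zero)
  have hDc : DifferentiableAt ℝ (fderiv ℝ c) a :=
    (hc.fderiv_right (m := 1) le_rfl).differentiableAt one_ne_zero
  have hDf : DifferentiableAt ℝ (fderiv ℝ f) (c a) :=
    (hf.fderiv_right (m := 1) le_rfl).differentiableAt one_ne_zero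
  have hDfc : HasFDerivAt (fun y => fderiv ℝ f (c y)) _ a :=
    hDf.hasFDerivAt.comp a (hc.differentiableAt two_ne_zero).hasFDerivAt
  rw [hcomp.fderiv_eq, (hDfc.clm_comp hDc.hasFDerivAt).fderiv]
  simp [add_comm]

/-- The covariant derivative `∂_v ∂_w c + Γ(∂_v c, ∂_w c)`, for the metric `h` on the target, of the
vector field `∂_w c` along the map `c`. -/
def secondCovDeriv (h : E → E →L[ℝ] E →L[ℝ] ℝ) (c : F → E) (a v w : F) : E :=
  fderiv ℝ (fderiv ℝ c) a v w + christoffel h (c a) (fderiv ℝ c a v) (fderiv ℝ c a w)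

theorem localHessian_comp (h : E → E →L[ℝ] E →L[ℝ] ℝ) (h' : F → F →L[ℝ] F →L[ℝ] ℝ)
    {c : F → E} {f : E → ℝ} {a : F} (hc : ContDiffAt ℝ 2 c a) (hf : ContDiffAt ℝ 2 f (c a))
    (v w : F) :
    localHessian h' (f ∘ c) a v w =
      localHessian h f (c a) (fderiv ℝ c a v) (fderiv ℝ c a w) +
        fderiv ℝ f (c a) (secondCovDeriv h c a v w - fderiv ℝ c a (christoffel h' a v w)) := by
  rw [localHessian_apply, localHessian_apply, fderiv_fderiv_comp hc hf, secondCovDeriv,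
    fderiv_comp a (hf.differentiableAt two_ne_zero) (hc.differentiableAt two_ne_zero),
    ContinuousLinearMap.comp_apply, map_sub, map_add]
  ring

/-- A symmetric positive definite bilinear form. -/
structure IsInnerProduct (b : E →L[ℝ] E →L[ℝ] ℝ) : Prop where
  symm : ∀ v w, b v w = b w v
  pos : ∀ v, v ≠ 0 → 0 < b v v

theorem IsInnerProduct.ext {b : E →L[ℝ] E →L[ℝ] ℝ} (hb : IsInnerProduct b) {v w : E}
    (hvw : ∀ a, b v a = b w a) : v = w := by
  by_contra hne
  refine (hb.pos (v - w) (sub_ne_zero.2 hne)).ne' ?_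
  rw [map_sub b, sub_apply, hvw, sub_self]

theorem IsInnerProduct.isInvertible [FiniteDimensional ℝ E] {b : E →L[ℝ] E →L[ℝ] ℝ}
    (hb : IsInnerProduct b) : b.IsInvertible := by
  have hinj : Function.Injective b.toLinearMap := fun v w hvw =>
    hb.ext fun a => congrArg (fun ℓ : E →L[ℝ] ℝ => ℓ a) hvw
  have hdim : finrank ℝ E = finrank ℝ (E →L[ℝ] ℝ) := by
    rw [← (LinearMap.toContinuousLinearMap (𝕜 := ℝ) (E := E) (F' := ℝ)).finrank_eq]
    exact (Subspace.dual_finrank_eq (K := ℝ) (V := E)).symm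
  exact ⟨(LinearEquiv.ofInjectiveOfFinrankEq b.toLinearMap hinj hdim).toContinuousLinearEquiv, rfl⟩

theorem contDiffAt_bilinearComp {G : Type*} [NormedAddCommGroup G] [NormedSpace ℝ G]
    {h : G → E →L[ℝ] E →L[ℝ] ℝ} {L : G → F →L[ℝ] E} {a : G} {n : ℕ∞}
    (hh : ContDiffAt ℝ n h a) (hL : ContDiffAt ℝ n L a) :
    ContDiffAt ℝ n (fun y => (h y).bilinearComp (L y) (L y)) a := by
  have hleft : ContDiffAt ℝ n (fun y => (h y ∘L L y).flip) a :=
    (ContinuousLinearMap.flipₗᵢ ℝ F E ℝ).contDiff.contDiffAt.comp a (hh.clm_comp hL)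
  exact (ContinuousLinearMap.flipₗᵢ ℝ F F ℝ).contDiff.contDiffAt.comp a (hleft.clm_comp hL)

theorem IsInnerProduct.bilinearComp {b : E →L[ℝ] E →L[ℝ] ℝ} (hb : IsInnerProduct b)
    {L : F →L[ℝ] E} (hL : Function.Injective L) : IsInnerProduct (b.bilinearComp L L) where
  symm v w := hb.symm (L v) (L w)
  pos v hv := hb.pos (L v) ((map_ne_zero_iff L hL).2 hv)

theorem christoffel_spec {h : E → E →L[ℝ] E →L[ℝ] ℝ} {y : E} (hy : (h y).IsInvertible)
    (v w a : E) : h y (christoffel h y v w) a =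
      (1 / 2 : ℝ) * (fderiv ℝ h y v w a + fderiv ℝ h y w v a - fderiv ℝ h y a v w) := by
  rw [christoffel, hy.self_apply_inverse]
  simp

theorem fderiv_pullback {c : F → E} {h : E → E →L[ℝ] E →L[ℝ] ℝ} {h' : F → F →L[ℝ] F →L[ℝ] ℝ}
    {a : F} (hc : ContDiffAt ℝ 2 c a) (hh : ContDiffAt ℝ 1 h (c a))
    (hh' : h' =ᶠ[𝓝 a] fun y => (h (c y)).bilinearComp (fderiv ℝ c y) (fderiv ℝ c y))
    (v w t : F) :
    fderiv ℝ h' a v w t =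
      fderiv ℝ h (c a) (fderiv ℝ c a v) (fderiv ℝ c a w) (fderiv ℝ c a t) +
      h (c a) (fderiv ℝ (fderiv ℝ c) a v w) (fderiv ℝ c a t) +
      h (c a) (fderiv ℝ c a w) (fderiv ℝ (fderiv ℝ c) a v t) := by
  have hDc1 : ContDiffAt ℝ 1 (fderiv ℝ c) a := hc.fderiv_right le_rfl
  have hDc : DifferentiableAt ℝ (fderiv ℝ c) a := hDc1.differentiableAt one_ne_zero
  have hh'diff : DifferentiableAt ℝ h' a :=
    ((contDiffAt_bilinearComp (hh.comp a (hc.of_le one_le_two)) hDc1).differentiableAt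
      one_ne_zero).congr_of_eventuallyEq hh'
  have hhc : HasFDerivAt (fun y => h (c y)) (fderiv ℝ h (c a) ∘L fderiv ℝ c a) a :=
    (hh.differentiableAt one_ne_zero).hasFDerivAt.comp a
      (hc.differentiableAt two_ne_zero).hasFDerivAt
  have hDc' (s : F) : HasFDerivAt (fun y => fderiv ℝ c y s) _ a :=
    hDc.hasFDerivAt.clm_apply (hasFDerivAt_const s a)
  have hhct : HasFDerivAt (fun y => h (c y) (fderiv ℝ c y w) (fderiv ℝ c y t)) _ a :=
    (hhc.clm_apply (hDc' w)).clm_apply (hDc' t)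
  have hh'wt : HasFDerivAt (fun y => h' y w t) _ a :=
    (hh'diff.hasFDerivAt.clm_apply (hasFDerivAt_const w a)).clm_apply (hasFDerivAt_const t a)
  have heq : (fun y => h' y w t) =ᶠ[𝓝 a] fun y => h (c y) (fderiv ℝ c y w) (fderiv ℝ c y t) := by
    filter_upwards [hh'] with y hy
    rw [hy, ContinuousLinearMap.bilinearComp_apply]
  have happly := congrArg (fun ℓ : F →L[ℝ] ℝ => ℓ v)
    (hh'wt.unique (hhct.congr_of_eventuallyEq heq))
  simp only [ContinuousLinearMap.comp_zero, zero_add, ContinuousLinearMap.flip_apply,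
    ContinuousLinearMap.flip_add, add_apply, ContinuousLinearMap.comp_apply] at happly
  linear_combination happly

/-- The Koszul formula makes `c_* Γ'` the tangential part of the second covariant derivative of
`c`, where `Γ'` belongs to the induced metric `h'`. -/
theorem christoffel_pullback {c : F → E} {h : E → E →L[ℝ] E →L[ℝ] ℝ} {h' : F → F →L[ℝ] F →L[ℝ] ℝ}
    {a : F} (hc : ContDiffAt ℝ 2 c a) (hh : ContDiffAt ℝ 1 h (c a))
    (hh' : h' =ᶠ[𝓝 a] fun y => (h (c y)).bilinearComp (fderiv ℝ c y) (fderiv ℝ c y))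
    (hsymm : ∀ s t, h (c a) s t = h (c a) t s) (hi : (h (c a)).IsInvertible)
    (hi' : (h' a).IsInvertible) (v w t : F) :
    h' a (christoffel h' a v w) t = h (c a) (secondCovDeriv h c a v w) (fderiv ℝ c a t) := by
  have hDc (s t : F) : fderiv ℝ (fderiv ℝ c) a s t = fderiv ℝ (fderiv ℝ c) a t s :=
    hc.isSymmSndFDerivAt (by simp) s t
  rw [secondCovDeriv, map_add, add_apply, christoffel_spec hi, christoffel_spec hi']
  simp only [fderiv_pullback hc hh hh']
  rw [hDc w v, hDc t v, hDc t w, hsymm (fderiv ℝ c a w)]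
  ring

theorem sum_localHessian_comp [FiniteDimensional ℝ E] [FiniteDimensional ℝ F]
    {c : F → E} {h : E → E →L[ℝ] E →L[ℝ] ℝ} {h' : F → F →L[ℝ] F →L[ℝ] ℝ} {f : E → ℝ} {a : F}
    (hc : ContDiffAt ℝ 2 c a) (hh : ContDiffAt ℝ 1 h (c a))
    (hh' : h' =ᶠ[𝓝 a] fun y => (h (c y)).bilinearComp (fderiv ℝ c y) (fderiv ℝ c y))
    (hi : IsInnerProduct (h (c a))) (hinj : Function.Injective (fderiv ℝ c a))
    (hf : ContDiffAt ℝ 2 f (c a)) {ι : Type*} [Fintype ι] (v w : ι → F)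
    (htan : ∑ j, secondCovDeriv h c a (v j) (w j) ∈ (fderiv ℝ c a).range) :
    ∑ j, localHessian h' (f ∘ c) a (v j) (w j) =
      ∑ j, localHessian h f (c a) (fderiv ℝ c a (v j)) (fderiv ℝ c a (w j)) := by
  have hi' : IsInnerProduct (h' a) := hh'.eq_of_nhds ▸ hi.bilinearComp hinj
  obtain ⟨t, ht⟩ := htan
  have hΓ : ∑ j, christoffel h' a (v j) (w j) = t := by
    refine hi'.ext fun b => ?_
    calc h' a (∑ j, christoffel h' a (v j) (w j)) b
      _ = h (c a) (∑ j, secondCovDeriv h c a (v j) (w j)) (fderiv ℝ c a b) := by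
        simp only [map_sum, sum_apply, christoffel_pullback hc hh hh' hi.symm hi.isInvertible
          hi'.isInvertible]
      _ = h' a t b := by rw [← ht, hh'.eq_of_nhds]; rfl
  simp only [localHessian_comp h h' hc hf, Finset.sum_add_distrib, ← map_sum,
    Finset.sum_sub_distrib, hΓ, ← ht]
  simp

end LocalHessian

section FormTrace

variable {E : Type*} [NormedAddCommGroup E] [NormedSpace ℝ E] {ι : Type*}

/-- The matrix of the values of a bilinear form on a family of vectors. -/
def formMatrix (B : E →L[ℝ] E →L[ℝ] ℝ) (β : ι → E) : Matrix ι ι ℝ :=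
  Matrix.of fun j k => B (β j) (β k)

theorem formMatrix_sum_smul [Fintype ι] (B : E →L[ℝ] E →L[ℝ] ℝ) (β : ι → E) (M : Matrix ι ι ℝ) :
    formMatrix B (fun k => ∑ j, M k j • β j) = M * formMatrix B β * M.transpose := by
  ext k l
  simp only [formMatrix, Matrix.of_apply, map_sum, sum_apply, map_smul, smul_apply, smul_eq_mul,
    Matrix.mul_apply, Matrix.transpose_apply, Finset.sum_mul, Finset.mul_sum]
  exact Finset.sum_congr rfl fun i _ => Finset.sum_congr rfl fun j _ => by ring

variable [Fintype ι] [DecidableEq ι]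

/-- The trace of the bilinear form `S`, with respect to the inner product `b`, over the span of the
frame `β`. It is `0` if the Gram matrix of `β` is singular. -/
def formTrace (b S : E →L[ℝ] E →L[ℝ] ℝ) (β : ι → E) : ℝ :=
  ((formMatrix b β)⁻¹ * formMatrix S β).trace

theorem formTrace_add (b S S' : E →L[ℝ] E →L[ℝ] ℝ) (β : ι → E) :
    formTrace b (S + S') β = formTrace b S β + formTrace b S' β := by
  have hadd : formMatrix (S + S') β = formMatrix S β + formMatrix S' β := rfl
  rw [formTrace, hadd, mul_add, Matrix.trace_add, formTrace, formTrace]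

theorem formTrace_smul (b : E →L[ℝ] E →L[ℝ] ℝ) (a : ℝ) (S : E →L[ℝ] E →L[ℝ] ℝ) (β : ι → E) :
    formTrace b (a • S) β = a * formTrace b S β := by
  have hsmul : formMatrix (a • S) β = a • formMatrix S β := rfl
  rw [formTrace, hsmul, mul_smul_comm, Matrix.trace_smul, formTrace, smul_eq_mul]

theorem formTrace_eq_sum (b S : E →L[ℝ] E →L[ℝ] ℝ) (β : ι → E) :
    formTrace b S β = ∑ j, ∑ k, (formMatrix b β)⁻¹ j k * S (β k) (β j) := by
  simp [formTrace, formMatrix, Matrix.trace, Matrix.mul_apply]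

/-- The matrix `M` expressing `e` in terms of `β` satisfies `M G Mᵀ = 1` for the Gram matrix `G` of
`β`, so `G⁻¹ = Mᵀ M`. -/
theorem exists_inv_formMatrix {b : E →L[ℝ] E →L[ℝ] ℝ} {e β : ι → E}
    (he : ∀ j k, b (e j) (e k) = if j = k then 1 else 0)
    (hspan : ∀ j, e j ∈ Submodule.span ℝ (Set.range β)) :
    ∃ M : Matrix ι ι ℝ, e = (fun k => ∑ j, M k j • β j) ∧
      formMatrix b β * (M.transpose * M) = 1 := by
  choose M hM using fun k => (Submodule.mem_span_range_iff_exists_fun ℝ).1 (hspan k)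
  have heM : e = fun k => ∑ j, Matrix.of M k j • β j := funext fun k => (hM k).symm
  have hone : formMatrix b e = 1 := by
    ext j k
    rw [formMatrix, Matrix.of_apply, he, Matrix.one_apply]
  refine ⟨Matrix.of M, heM, ?_⟩
  rw [heM, formMatrix_sum_smul, mul_assoc] at hone
  rw [← mul_assoc]
  exact mul_eq_one_comm.1 hone

theorem isUnit_det_formMatrix {b : E →L[ℝ] E →L[ℝ] ℝ} {e β : ι → E}
    (he : ∀ j k, b (e j) (e k) = if j = k then 1 else 0)
    (hspan : ∀ j, e j ∈ Submodule.span ℝ (Set.range β)) : IsUnit (formMatrix b β).det :=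
  let ⟨_, _, hM⟩ := exists_inv_formMatrix he hspan
  Matrix.isUnit_det_of_right_inverse hM

theorem sum_eq_formTrace {b : E →L[ℝ] E →L[ℝ] ℝ} {e β : ι → E}
    (he : ∀ j k, b (e j) (e k) = if j = k then 1 else 0)
    (hspan : ∀ j, e j ∈ Submodule.span ℝ (Set.range β)) (S : E →L[ℝ] E →L[ℝ] ℝ) :
    ∑ j, S (e j) (e j) = formTrace b S β := by
  obtain ⟨M, heM, hM⟩ := exists_inv_formMatrix he hspan
  calc ∑ j, S (e j) (e j)
    _ = (M * formMatrix S β * M.transpose).trace := by rw [← formMatrix_sum_smul, ← heM]; rfl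
    _ = (M.transpose * M * formMatrix S β).trace := by
      rw [Matrix.trace_mul_comm, ← Matrix.mul_assoc]
    _ = formTrace b S β := by rw [formTrace, Matrix.inv_eq_right_inv hM]

theorem exists_orthonormal_basis {V : Type*} [AddCommGroup V] [Module ℝ V] [FiniteDimensional ℝ V]
    (B : V →ₗ[ℝ] V →ₗ[ℝ] ℝ) (hsymm : ∀ v w, B v w = B w v) (hpos : ∀ v, v ≠ 0 → 0 < B v v) :
    ∃ e : Basis (Fin (finrank ℝ V)) ℝ V, ∀ j k, B (e j) (e k) = if j = k then 1 else 0 := by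
  let core : InnerProductSpace.Core ℝ V :=
    { inner v w := B v w
      conj_inner_symm v w := hsymm w v
      re_inner_nonneg v := by
        rcases eq_or_ne v 0 with rfl | hv
        · simp
        · exact (hpos v hv).le
      add_left := by simp
      smul_left := by simp
      definite v hv := by
        by_contra hne
        exact (hpos v hne).ne' hv }
  let := core.toNormedAddCommGroup
  let : InnerProductSpace ℝ V := .ofCore core.toCore
  let e := stdOrthonormalBasis ℝ V
  refine ⟨e.toBasis, fun j k => ?_⟩
  rw [e.coe_toBasis]
  exact orthonormal_iff_ite.1 e.orthonormal j k

theorem IsInnerProduct.exists_orthonormal {p : ℕ} {b : E →L[ℝ] E →L[ℝ] ℝ} (hb : IsInnerProduct b)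
    (W : Submodule ℝ E) [FiniteDimensional ℝ W] (hW : finrank ℝ W = p) :
    ∃ e : Fin p → E, (∀ j k, b (e j) (e k) = if j = k then 1 else 0) ∧
      Submodule.span ℝ (Set.range e) = W := by
  subst hW
  obtain ⟨e, he⟩ := exists_orthonormal_basis (b.toLinearMap₁₂.domRestrict₁₂ W W)
    (fun v w => hb.symm v w) (fun v hv => hb.pos v (by simpa using hv))
  refine ⟨fun j => e j, he, ?_⟩
  rw [show (fun j => (e j : E)) = W.subtype ∘ e from rfl, Set.range_comp, ← Submodule.map_span,
    e.span_eq, Submodule.map_top, Submodule.range_subtype]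

section ContDiff

variable {G : Type*} [NormedAddCommGroup G] [NormedSpace ℝ G] {n : WithTop ℕ∞} {y : G}

theorem contDiffAt_det {A : G → Matrix ι ι ℝ} (hA : ∀ j k, ContDiffAt ℝ n (fun z => A z j k) y) :
    ContDiffAt ℝ n (fun z => (A z).det) y := by
  simp only [Matrix.det_apply']
  exact ContDiffAt.sum fun σ _ => contDiffAt_const.mul (contDiffAt_prod fun i _ => hA _ _)

theorem contDiffAt_matrix_inv {A : G → Matrix ι ι ℝ}
    (hA : ∀ j k, ContDiffAt ℝ n (fun z => A z j k) y) (hy : IsUnit (A y).det) (j k : ι) :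
    ContDiffAt ℝ n (fun z => (A z)⁻¹ j k) y := by
  simp only [Matrix.inv_def, Matrix.smul_apply, smul_eq_mul, Ring.inverse_eq_inv',
    Matrix.adjugate_apply]
  refine ((contDiffAt_det hA).inv hy.ne_zero).mul (contDiffAt_det fun a b => ?_)
  by_cases hak : a = k
  · simp only [hak, Matrix.updateRow_self]
    exact contDiffAt_const
  · simp only [Matrix.updateRow_ne hak]
    exact hA a b

theorem contDiffAt_inv_formMatrix {h : G → E →L[ℝ] E →L[ℝ] ℝ} {β : G → ι → E}
    (hh : ContDiffAt ℝ n h y) (hβ : ContDiffAt ℝ n β y)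
    (hdet : IsUnit (formMatrix (h y) (β y)).det) (j k : ι) :
    ContDiffAt ℝ n (fun z => (formMatrix (h z) (β z))⁻¹ j k) y :=
  contDiffAt_matrix_inv (fun j k =>
    (hh.clm_apply (contDiffAt_pi.1 hβ j)).clm_apply (contDiffAt_pi.1 hβ k)) hdet j k

theorem contDiffAt_formTrace {h S : G → E →L[ℝ] E →L[ℝ] ℝ} {β : G → ι → E}
    (hh : ContDiffAt ℝ n h y) (hS : ContDiffAt ℝ n S y) (hβ : ContDiffAt ℝ n β y)
    (hdet : IsUnit (formMatrix (h y) (β y)).det) :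
    ContDiffAt ℝ n (fun z => formTrace (h z) (S z) (β z)) y := by
  simp only [formTrace_eq_sum]
  exact ContDiffAt.sum fun j _ => ContDiffAt.sum fun k _ =>
    (contDiffAt_inv_formMatrix hh hβ hdet j k).mul
      ((hS.clm_apply (contDiffAt_pi.1 hβ k)).clm_apply (contDiffAt_pi.1 hβ j))

end ContDiff

end FormTrace

section Penalization

open Filter

variable {E : Type*} [TopologicalSpace E] {K : Set E} {u : E → EReal} {f q : E → ℝ} {y₀ : E}

theorem exists_isMaxOn_sub (hK : IsCompact K) (hu : UpperSemicontinuousOn u K)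
    (htop : ∀ y ∈ K, u y ≠ ⊤) (hf : ContinuousOn f K) (hy₀ : y₀ ∈ K) (huy₀ : f y₀ ≤ u y₀) :
    ∃ y ∈ K, ∃ c : ℝ, 0 ≤ c ∧ u y = ((f y + c : ℝ) : EReal) ∧
      ∀ z ∈ K, u z ≤ ((f z + c : ℝ) : EReal) := by
  have hneg : ContinuousOn (fun y => -(f y : EReal)) K :=
    (continuous_neg.comp continuous_coe_real_ereal).comp_continuousOn hf
  have husub : UpperSemicontinuousOn (fun y => u y - f y) K :=
    hu.add' hneg.upperSemicontinuousOn fun y hy =>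
      EReal.continuousAt_add (.inl (htop y hy)) (.inr (by simp))
  obtain ⟨y, hy, hmax⟩ := husub.exists_isMaxOn ⟨y₀, hy₀⟩ hK
  have hnonneg : 0 ≤ u y - f y := (EReal.sub_nonneg (by simp) (by simp)).2 huy₀ |>.trans (hmax hy₀)
  have hbot : u y ≠ ⊥ := by
    rintro hbot
    simp [hbot] at hnonneg
  lift u y to ℝ using ⟨htop y hy, hbot⟩ with U hU
  refine ⟨y, hy, U - f y, by exact_mod_cast hnonneg, by simp [hU], fun z hz => ?_⟩
  have hz' : u z - f z ≤ ((U - f y : ℝ) : EReal) := by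
    have hle : u z - f z ≤ u y - f y := hmax hz
    rwa [← hU] at hle
  rwa [EReal.sub_le_iff_le_add (by simp) (by simp), ← EReal.coe_add, add_comm] at hz'

theorem tendsto_of_penalized_le (hK : IsCompact K) (hu : UpperSemicontinuousOn u K)
    (htop : ∀ y ∈ K, u y ≠ ⊤) (hf : ContinuousOn f K) (hq : ContinuousOn q K)
    (hq0 : ∀ y ∈ K, 0 ≤ q y) (hlt : ∀ y ∈ K, q y = 0 → y ≠ y₀ → u y < f y)
    {y : ℕ → E} (hyK : ∀ n, y n ∈ K) (hle : ∀ n, ((f (y n) + n * q (y n) : ℝ) : EReal) ≤ u (y n)) :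
    Tendsto y atTop (𝓝 y₀) := by
  rw [(nhds_basis_opens y₀).tendsto_right_iff]
  rintro U ⟨hy₀U, hU⟩
  suffices ∀ᶠ n : ℕ in atTop, ∀ z ∈ K \ U, u z < ((f z + n * q z : ℝ) : EReal) by
    filter_upwards [this] with n hn
    by_contra hyU
    exact (hn _ ⟨hyK n, hyU⟩).not_ge (hle n)
  refine (hK.diff hU).induction_on (p := fun s => ∀ᶠ n : ℕ in atTop, ∀ z ∈ s,
    u z < ((f z + n * q z : ℝ) : EReal)) (by simp) (fun s t hst ht => ?_) (fun s t hs ht => ?_)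
    fun a ha => ?_
  · exact ht.mono fun n hn z hz => hn z (hst hz)
  · filter_upwards [hs, ht] with n hns hnt z hz using hz.elim (hns z) (hnt z)
  have haN : ∃ N : ℕ, u a < ((f a + N * q a : ℝ) : EReal) := by
    rcases (hq0 a ha.1).eq_or_lt with hqa | hqa
    · exact ⟨0, by simpa using hlt a ha.1 hqa.symm fun h => ha.2 (h ▸ hy₀U)⟩
    · obtain ⟨r, hr, -⟩ := EReal.lt_iff_exists_real_btwn.1 (htop a ha.1).lt_top
      obtain ⟨N, hN⟩ := exists_nat_gt ((r - f a) / q a)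
      refine ⟨N, hr.trans (EReal.coe_lt_coe_iff.2 ?_)⟩
      linarith [(div_lt_iff₀ hqa).1 hN]
  obtain ⟨N, hN⟩ := haN
  obtain ⟨r, hur, hrf⟩ := EReal.lt_iff_exists_real_btwn.1 hN
  have hcont : ContinuousWithinAt (fun z => f z + N * q z) (K \ U) a :=
    ((hf.add (continuousOn_const.mul hq)) a ha.1).mono Set.sdiff_subset
  have hnear : ∀ᶠ z in 𝓝[K \ U] a, z ∈ K ∧ u z < r ∧ r < f z + N * q z :=
    (eventually_mem_nhdsWithin.mono fun z hz => hz.1).and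
      ((((hu a ha.1).mono Set.sdiff_subset) r hur).and
        (hcont.eventually (lt_mem_nhds (EReal.coe_lt_coe_iff.1 hrf))))
  refine ⟨_, hnear, ?_⟩
  filter_upwards [eventually_ge_atTop N] with n hn z ⟨hzK, huz, hrz⟩
  refine huz.trans (EReal.coe_lt_coe_iff.2 (hrz.trans_le ?_))
  have := hq0 z hzK
  gcongr

theorem tendsto_penalty_zero (hu : UpperSemicontinuousWithinAt u K y₀)
    (hf : ContinuousWithinAt f K y₀) (hq0 : ∀ y ∈ K, 0 ≤ q y) (huy₀ : u y₀ ≤ f y₀)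
    {y : ℕ → E} (hyK : ∀ n, y n ∈ K) (hle : ∀ n, ((f (y n) + n * q (y n) : ℝ) : EReal) ≤ u (y n))
    (hy : Tendsto y atTop (𝓝 y₀)) : Tendsto (fun n => n * q (y n)) atTop (𝓝 0) := by
  have hyK' : Tendsto y atTop (𝓝[K] y₀) := tendsto_nhdsWithin_iff.2 ⟨hy, .of_forall hyK⟩
  refine tendsto_order.2 ⟨fun a ha => .of_forall fun n => ha.trans_le
    (mul_nonneg n.cast_nonneg (hq0 _ (hyK n))), fun ε hε => ?_⟩
  have hlt : u y₀ < ((f y₀ + ε / 2 : ℝ) : EReal) :=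
    huy₀.trans_lt (EReal.coe_lt_coe_iff.2 (by linarith))
  filter_upwards [hyK'.eventually (hu _ hlt),
    (hf.tendsto.comp hyK').eventually (lt_mem_nhds (sub_lt_self (f y₀) (half_pos hε)))]
    with n hun hfn
  have := EReal.coe_lt_coe_iff.1 ((hle n).trans_lt hun)
  simp only [Function.comp_apply] at hfn
  linarith

theorem exists_penalized_max (hK : IsCompact K) (hu : UpperSemicontinuousOn u K)
    (htop : ∀ y ∈ K, u y ≠ ⊤) (hf : ContinuousOn f K) (hq : ContinuousOn q K)
    (hq0 : ∀ y ∈ K, 0 ≤ q y) (hy₀ : y₀ ∈ K) (hqy₀ : q y₀ = 0) (huy₀ : u y₀ = f y₀)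
    (hlt : ∀ y ∈ K, q y = 0 → y ≠ y₀ → u y < f y) :
    ∃ (y : ℕ → E) (c : ℕ → ℝ), Tendsto y atTop (𝓝 y₀) ∧
      Tendsto (fun n => n * q (y n)) atTop (𝓝 0) ∧
      ∀ n, u (y n) = ((f (y n) + n * q (y n) + c n : ℝ) : EReal) ∧
        ∀ z ∈ K, u z ≤ ((f z + n * q z + c n : ℝ) : EReal) := by
  choose y hyK c hc huy hle using fun n : ℕ => exists_isMaxOn_sub
    (f := fun z => f z + n * q z) hK hu htop (hf.add (continuousOn_const.mul hq)) hy₀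
    (by simp [hqy₀, huy₀])
  have hfle (n : ℕ) : ((f (y n) + n * q (y n) : ℝ) : EReal) ≤ u (y n) := by
    rw [huy, EReal.coe_le_coe_iff]
    linarith [hc n]
  have hy := tendsto_of_penalized_le hK hu htop hf hq hq0 hlt hyK hfle
  exact ⟨y, c, hy, tendsto_penalty_zero (hu y₀ hy₀) (hf y₀ hy₀) hq0 huy₀.le hyK hfle hy,
    fun n => ⟨huy n, hle n⟩⟩

end Penalization

section LocalRestriction

open Filter Asymptotics

variable {E : Type*} [NormedAddCommGroup E] [NormedSpace ℝ E] {ι : Type*} [Fintype ι]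
  [DecidableEq ι] {h : E → E →L[ℝ] E →L[ℝ] ℝ} {β : E → ι → E} {y₀ : E}

/-- The trace of the Hessian of `f` over the span of the frame `β y`. -/
def hessianTrace (h : E → E →L[ℝ] E →L[ℝ] ℝ) (β : E → ι → E) (f : E → ℝ) (y : E) : ℝ :=
  formTrace (h y) (localHessian h f y) (β y)

theorem hessianTrace_add {f f' : E → ℝ} {y : E} (hf : ContDiffAt ℝ 2 f y)
    (hf' : ContDiffAt ℝ 2 f' y) :
    hessianTrace h β (f + f') y = hessianTrace h β f y + hessianTrace h β f' y := by
  rw [hessianTrace, localHessian_add h hf hf', formTrace_add, hessianTrace, hessianTrace]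

theorem hessianTrace_const_smul (a : ℝ) (f : E → ℝ) (y : E) :
    hessianTrace h β (a • f) y = a * hessianTrace h β f y := by
  rw [hessianTrace, localHessian_const_smul, formTrace_smul, hessianTrace]

theorem hessianTrace_sum {κ : Type*} (s : Finset κ) {f : κ → E → ℝ} {y : E}
    (hf : ∀ k ∈ s, ContDiffAt ℝ 2 (f k) y) :
    hessianTrace h β (fun z => ∑ k ∈ s, f k z) y = ∑ k ∈ s, hessianTrace h β (f k) y := by
  classical
  induction s using Finset.induction_on with
  | empty =>
    have hzero : hessianTrace h β 0 y = 0 := by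
      simpa using hessianTrace_const_smul (h := h) (β := β) 0 (0 : E → ℝ) y
    exact hzero
  | insert k s hk ih =>
    have hs := fun l hl => hf l (Finset.mem_insert_of_mem hl)
    have hinsert : (fun z => ∑ l ∈ insert k s, f l z) = f k + fun z => ∑ l ∈ s, f l z :=
      funext fun z => Finset.sum_insert hk
    rw [hinsert, hessianTrace_add (hf k (Finset.mem_insert_self k s)) (ContDiffAt.sum hs), ih hs,
      Finset.sum_insert hk]

theorem contDiffAt_hessianTrace [CompleteSpace E] {n : ℕ∞} (hh : ContDiffAt ℝ (n + 1) h y₀)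
    (hi : (h y₀).IsInvertible) (hβ : ContDiffAt ℝ n β y₀)
    (hdet : IsUnit (formMatrix (h y₀) (β y₀)).det) {f : E → ℝ} (hf : ContDiffAt ℝ (n + 2) f y₀) :
    ContDiffAt ℝ n (hessianTrace h β f) y₀ :=
  contDiffAt_formTrace (hh.of_le le_self_add) (contDiffAt_localHessian hh hi hf) hβ hdet

theorem hessianTrace_clm_sq (ℓ : E →L[ℝ] ℝ) (y : E) :
    hessianTrace h β (fun z => ℓ z ^ 2) y =
      2 * formTrace (h y) (ℓ.smulRight ℓ) (β y) + 2 * ℓ y * hessianTrace h β ℓ y := by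
  have hD : fderiv ℝ (fun z => ℓ z ^ 2) = fun z => (2 * ℓ z) • ℓ := by
    ext1 z
    rw [((ℓ.hasFDerivAt (x := z)).pow 2).fderiv]
    simp
  have hDℓ : fderiv ℝ ℓ = fun _ => ℓ := funext fun z => ℓ.fderiv
  have hD2 : fderiv ℝ (fun z => (2 * ℓ z) • ℓ) y = (2 : ℝ) • ℓ.smulRight ℓ := by
    rw [(((ℓ.hasFDerivAt (x := y)).const_mul 2).smul_const ℓ).fderiv]
    ext v w
    simp
    ring
  have hform : localHessian h (fun z => ℓ z ^ 2) y =
      (2 : ℝ) • ℓ.smulRight ℓ + (2 * ℓ y) • localHessian h ℓ y := by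
    ext v w
    rw [localHessian_apply, hD, hD2]
    simp [localHessian_apply, hDℓ]
    ring
  rw [hessianTrace, hform, formTrace_add, formTrace_smul, formTrace_smul, hessianTrace]

theorem isBigO_of_vanishing_on_ker {V G : Type*} [NormedAddCommGroup V] [NormedSpace ℝ V]
    [FiniteDimensional ℝ V] [NormedAddCommGroup G] [NormedSpace ℝ G] {P : E →L[ℝ] V}
    (hP : Function.Surjective P) (hy₀ : P y₀ = 0) {φ : E → G} (hφ : ContDiffAt ℝ 1 φ y₀)
    (hvan : ∀ᶠ y in 𝓝 y₀, P y = 0 → φ y = 0) : φ =O[𝓝 y₀] P := by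
  obtain ⟨T, hT⟩ := P.exists_rightInverse_of_surjective (LinearMap.range_eq_top.2 hP)
  have hPT (v : V) : P (T v) = v := congrArg (fun L : V →L[ℝ] V => L v) hT
  obtain ⟨K, t, ht, hK⟩ := hφ.exists_lipschitzOnWith
  have hproj : Tendsto (fun y => y - T (P y)) (𝓝 y₀) (𝓝 y₀) := by
    have hcont : Continuous fun y => y - T (P y) := by fun_prop
    simpa [hy₀] using hcont.tendsto y₀
  refine IsBigO.of_bound (K * ‖T‖) ?_
  filter_upwards [ht, hproj.eventually ht, hproj.eventually hvan] with y hy hyt hyvan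
  calc ‖φ y‖
    _ = ‖φ y - φ (y - T (P y))‖ := by rw [hyvan (by simp [hPT]), sub_zero]
    _ ≤ K * ‖y - (y - T (P y))‖ := hK.norm_sub_le hy hyt
    _ ≤ K * (‖T‖ * ‖P y‖) := by
      rw [sub_sub_cancel]
      gcongr
      exact T.le_opNorm _
    _ = K * ‖T‖ * ‖P y‖ := (mul_assoc _ _ _).symm

/-- Vanishing traces of the Hessians of the linear forms that define `ker P` say that `ker P` has
vanishing trace of the second fundamental form; together with tangency of the frame this makes all
terms of `hessianTrace_clm_sq` quadratically small. -/
theorem isBigO_hessianTrace_clm_sq [CompleteSpace E] {V : Type*} [NormedAddCommGroup V]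
    [NormedSpace ℝ V] [FiniteDimensional ℝ V] {P : E →L[ℝ] V} (hP : Function.Surjective P)
    (hy₀ : P y₀ = 0) (hh : ContDiffAt ℝ 2 h y₀) (hi : (h y₀).IsInvertible)
    (hβ : ContDiffAt ℝ 1 β y₀) (hdet : IsUnit (formMatrix (h y₀) (β y₀)).det) (ℓ : V →L[ℝ] ℝ)
    (htan : ∀ᶠ y in 𝓝 y₀, P y = 0 → ∀ j, P (β y j) = 0)
    (hflat : ∀ᶠ y in 𝓝 y₀, P y = 0 → hessianTrace h β (ℓ ∘L P) y = 0) :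
    hessianTrace h β (fun y => ℓ (P y) ^ 2) =O[𝓝 y₀] fun y => ‖P y‖ ^ 2 := by
  have hℓP : (fun y => ℓ (P y)) =O[𝓝 y₀] fun y => ‖P y‖ := (ℓ.isBigO_comp P _).norm_right
  have hℓβ (j : ι) : (fun y => ℓ (P (β y j))) =O[𝓝 y₀] fun y => ‖P y‖ :=
    (isBigO_of_vanishing_on_ker hP hy₀ ((ℓ ∘L P).contDiff.contDiffAt.comp y₀ (contDiffAt_pi.1 hβ j))
      (htan.mono fun y hy hPy => by simp [hy hPy])).norm_right
  have hHess : hessianTrace h β (ℓ ∘L P) =O[𝓝 y₀] fun y => ‖P y‖ :=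
    (isBigO_of_vanishing_on_ker hP hy₀ (contDiffAt_hessianTrace (n := 1)
      (by rwa [WithTop.coe_one, one_add_one_eq_two]) hi hβ hdet (ℓ ∘L P).contDiff.contDiffAt)
      hflat).norm_right
  have hgram (j k : ι) : (fun y => (formMatrix (h y) (β y))⁻¹ j k) =O[𝓝 y₀] fun _ => (1 : ℝ) :=
    (contDiffAt_inv_formMatrix (hh.of_le one_le_two) hβ hdet j k).continuousAt.isBigO_one ℝ
  have htrace : (fun y => formTrace (h y) ((ℓ ∘L P).smulRight (ℓ ∘L P)) (β y)) =O[𝓝 y₀]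
      fun y => ‖P y‖ ^ 2 := by
    simp only [formTrace_eq_sum, sq]
    refine IsBigO.fun_sum fun j _ => IsBigO.fun_sum fun k _ => ?_
    simpa using (hgram j k).mul ((hℓβ k).mul (hℓβ j))
  have hexpand : hessianTrace h β (fun y => ℓ (P y) ^ 2) = fun y =>
      2 * formTrace (h y) ((ℓ ∘L P).smulRight (ℓ ∘L P)) (β y) +
        2 * ℓ (P y) * hessianTrace h β (ℓ ∘L P) y :=
    funext fun y => hessianTrace_clm_sq (ℓ ∘L P) y
  rw [hexpand]
  refine (htrace.const_mul_left 2).add ?_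
  simpa only [sq] using (hℓP.const_mul_left 2).mul hHess

theorem exists_surjective_clm_ker_eq [FiniteDimensional ℝ E] (S : Submodule ℝ E) :
    ∃ (m : ℕ) (P : E →L[ℝ] Fin m → ℝ), Function.Surjective P ∧ ∀ y, P y = 0 ↔ y ∈ S := by
  let e : (E ⧸ S) ≃ₗ[ℝ] Fin (finrank ℝ (E ⧸ S)) → ℝ := .ofFinrankEq _ _ (by simp)
  refine ⟨_, (e.toLinearMap ∘ₗ S.mkQ).toContinuousLinearMap, ?_, fun y => ?_⟩
  · exact e.surjective.comp S.mkQ_surjective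
  · simp

theorem exists_penalty [FiniteDimensional ℝ E] {S : Submodule ℝ E} (hh : ContDiffAt ℝ 2 h y₀)
    (hi : (h y₀).IsInvertible) (hβ : ContDiffAt ℝ 1 β y₀)
    (hdet : IsUnit (formMatrix (h y₀) (β y₀)).det) (hy₀ : y₀ ∈ S)
    (htan : ∀ᶠ y in 𝓝 y₀, y ∈ S → ∀ j, β y j ∈ S)
    (hflat : ∀ᶠ y in 𝓝 y₀, y ∈ S → ∀ ℓ : E →L[ℝ] ℝ, (∀ v ∈ S, ℓ v = 0) →
      hessianTrace h β ℓ y = 0) :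
    ∃ q : E → ℝ, ContDiff ℝ 2 q ∧ (∀ y, 0 ≤ q y) ∧ (∀ y, q y = 0 ↔ y ∈ S) ∧
      hessianTrace h β q =O[𝓝 y₀] q := by
  obtain ⟨m, P, hP, hPS⟩ := exists_surjective_clm_ker_eq S
  have hcoord (a : Fin m) : ContDiff ℝ 2 fun y => P y a ^ 2 :=
    (ContinuousLinearMap.proj a ∘L P : E →L[ℝ] ℝ).contDiff.pow 2
  have hnorm (y : E) : ‖P y‖ ^ 2 ≤ ∑ a, P y a ^ 2 := by
    rw [← Real.le_sqrt (norm_nonneg _) (Finset.sum_nonneg fun a _ => sq_nonneg _),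
      pi_norm_le_iff_of_nonneg (Real.sqrt_nonneg _)]
    exact fun a => Real.abs_le_sqrt
      (Finset.single_le_sum (fun b _ => sq_nonneg (P y b)) (Finset.mem_univ a))
  refine ⟨fun y => ∑ a, P y a ^ 2, ContDiff.sum fun a _ => hcoord a,
    fun y => Finset.sum_nonneg fun a _ => sq_nonneg _, fun y => ?_, ?_⟩
  · rw [Finset.sum_eq_zero_iff_of_nonneg fun a _ => sq_nonneg _, ← hPS, funext_iff]
    simp
  have hsum : hessianTrace h β (fun y => ∑ a, P y a ^ 2) =
      fun y => ∑ a, hessianTrace h β (fun y => P y a ^ 2) y :=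
    funext fun y => hessianTrace_sum _ fun a _ => (hcoord a).contDiffAt
  rw [hsum]
  refine IsBigO.trans (g := fun y => ‖P y‖ ^ 2) (IsBigO.fun_sum fun a _ => ?_)
    (.of_bound 1 (.of_forall fun y => ?_))
  · refine isBigO_hessianTrace_clm_sq hP ((hPS y₀).2 hy₀) hh hi hβ hdet
      (ContinuousLinearMap.proj a) (by simpa only [hPS] using htan) ?_
    filter_upwards [hflat] with y hy hPy
    exact hy ((hPS y).1 hPy) _ fun v hv => by simp [(hPS v).2 hv]
  · rw [one_mul, Real.norm_of_nonneg (sq_nonneg _)]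
    exact (hnorm y).trans (le_abs_self _)

/-- `u` satisfies `trace (Hess u) ≥ 0` in the viscosity sense at `y`, the trace being taken over the
span of the frame `β y`. -/
def FrameSubharmonicAt (h : E → E →L[ℝ] E →L[ℝ] ℝ) (β : E → ι → E) (u : E → EReal) (y : E) : Prop :=
  ∀ f : E → ℝ, ContDiffAt ℝ 2 f y → (∀ᶠ z in 𝓝 y, u z ≤ f z) → u y = f y →
    0 ≤ hessianTrace h β f y

theorem FrameSubharmonicAt.hessianTrace_nonneg {u : E → EReal} {y : E}
    (hu : FrameSubharmonicAt h β u y) {f : E → ℝ} {c : ℝ} (hf : ContDiffAt ℝ 2 f y)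
    (hle : ∀ᶠ z in 𝓝 y, u z ≤ ((f z + c : ℝ) : EReal)) (heq : u y = ((f y + c : ℝ) : EReal)) :
    0 ≤ hessianTrace h β f y := by
  have hfc := hu (fun z => f z + c) (hf.add contDiffAt_const) hle heq
  rwa [hessianTrace, localHessian_add_const] at hfc

variable [FiniteDimensional ℝ E] {S : Submodule ℝ E} {u : E → EReal} {f : E → ℝ}

theorem hessianTrace_nonneg_of_lt (hh : ContDiffAt ℝ 2 h y₀) (hi : (h y₀).IsInvertible)
    (hβ : ContDiffAt ℝ 1 β y₀) (hdet : IsUnit (formMatrix (h y₀) (β y₀)).det) (hy₀ : y₀ ∈ S)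
    (htan : ∀ᶠ y in 𝓝 y₀, y ∈ S → ∀ j, β y j ∈ S)
    (hflat : ∀ᶠ y in 𝓝 y₀, y ∈ S → ∀ ℓ : E →L[ℝ] ℝ, (∀ v ∈ S, ℓ v = 0) → hessianTrace h β ℓ y = 0)
    (husc : ∀ᶠ y in 𝓝 y₀, UpperSemicontinuousAt u y) (htop : ∀ᶠ y in 𝓝 y₀, u y ≠ ⊤)
    (hu : ∀ᶠ y in 𝓝 y₀, FrameSubharmonicAt h β u y) (hf : ContDiffAt ℝ 2 f y₀)
    (hlt : ∀ᶠ y in 𝓝 y₀, y ∈ S → y ≠ y₀ → u y < f y) (heq : u y₀ = f y₀) :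
    0 ≤ hessianTrace h β f y₀ := by
  obtain ⟨q, hq, hq0, hqS, hqO⟩ := exists_penalty hh hi hβ hdet hy₀ htan hflat
  obtain ⟨r, hr, hball⟩ := Metric.nhds_basis_closedBall.eventually_iff.1
    (husc.and (htop.and (hu.and (hlt.and (hf.eventually (by simp))))))
  obtain ⟨y, c, hy, hnq, hmax⟩ := exists_penalized_max (isCompact_closedBall y₀ r)
    (fun y hy => (hball hy).1.upperSemicontinuousWithinAt _) (fun y hy => (hball hy).2.1)
    (fun y hy => (hball hy).2.2.2.2.continuousAt.continuousWithinAt)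
    hq.continuous.continuousOn (fun y _ => hq0 y) (Metric.mem_closedBall_self hr.le)
    ((hqS y₀).2 hy₀) heq (fun y hyK hqy => (hball hyK).2.2.2.1 ((hqS y).1 hqy))
  have hnonneg : ∀ᶠ n : ℕ in atTop,
      0 ≤ hessianTrace h β f (y n) + n * hessianTrace h β q (y n) := by
    filter_upwards [hy.eventually (Metric.ball_mem_nhds y₀ hr)] with n hyn
    obtain ⟨-, -, huy, -, hfy⟩ := hball (Metric.ball_subset_closedBall hyn)
    have hnq : ContDiffAt ℝ 2 ((n : ℝ) • q) (y n) := hq.contDiffAt.const_smul (n : ℝ)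
    rw [← hessianTrace_const_smul, ← hessianTrace_add hfy hnq]
    refine huy.hessianTrace_nonneg (hfy.add hnq) ?_ (hmax n).1
    filter_upwards [Metric.isOpen_ball.mem_nhds hyn] with z hz
    exact (hmax n).2 z (Metric.ball_subset_closedBall hz)
  have hlim : Tendsto (fun n => hessianTrace h β f (y n) + n * hessianTrace h β q (y n)) atTop
      (𝓝 (hessianTrace h β f y₀ + 0)) :=
    ((contDiffAt_hessianTrace (n := 0) (hh.of_le (by simp)) hi (hβ.of_le (by simp)) hdet
      (by simpa using hf)).continuousAt.tendsto.comp hy).add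
      (((isBigO_refl _ _).mul (hqO.comp_tendsto hy)).trans_tendsto hnq)
  simpa using ge_of_tendsto hlim hnonneg

theorem hessianTrace_nonneg_of_le (hh : ContDiffAt ℝ 2 h y₀) (hi : (h y₀).IsInvertible)
    (hβ : ContDiffAt ℝ 1 β y₀) (hdet : IsUnit (formMatrix (h y₀) (β y₀)).det) (hy₀ : y₀ ∈ S)
    (htan : ∀ᶠ y in 𝓝 y₀, y ∈ S → ∀ j, β y j ∈ S)
    (hflat : ∀ᶠ y in 𝓝 y₀, y ∈ S → ∀ ℓ : E →L[ℝ] ℝ, (∀ v ∈ S, ℓ v = 0) → hessianTrace h β ℓ y = 0)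
    (husc : ∀ᶠ y in 𝓝 y₀, UpperSemicontinuousAt u y) (htop : ∀ᶠ y in 𝓝 y₀, u y ≠ ⊤)
    (hu : ∀ᶠ y in 𝓝 y₀, FrameSubharmonicAt h β u y) (hf : ContDiffAt ℝ 2 f y₀)
    (hle : ∀ᶠ y in 𝓝 y₀, y ∈ S → u y ≤ f y) (heq : u y₀ = f y₀) :
    0 ≤ hessianTrace h β f y₀ := by
  let s : E → ℝ := fun y => ‖toEuclidean (y - y₀)‖ ^ 2
  have hs : ContDiff ℝ 2 s :=
    ((toEuclidean (E := E)).contDiff.comp (contDiff_id.sub contDiff_const)).norm_sq ℝ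
  have hspos (y : E) (hy : y ≠ y₀) : 0 < s y := by
    have hne : toEuclidean (y - y₀) ≠ 0 := by simpa [sub_eq_zero] using hy
    positivity
  have hnonneg (δ : ℝ) (hδ : 0 < δ) : 0 ≤ hessianTrace h β f y₀ + δ * hessianTrace h β s y₀ := by
    have hδs : ContDiffAt ℝ 2 (δ • s) y₀ := hs.contDiffAt.const_smul δ
    rw [← hessianTrace_const_smul, ← hessianTrace_add hf hδs]
    refine hessianTrace_nonneg_of_lt hh hi hβ hdet hy₀ htan hflat husc htop hu (hf.add hδs) ?_
      (by simp [heq, s])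
    filter_upwards [hle] with y hy hyS hne
    exact (hy hyS).trans_lt (EReal.coe_lt_coe_iff.2
      (lt_add_of_pos_right _ (mul_pos hδ (hspos y hne))))
  have hlim : Tendsto (fun δ : ℝ => hessianTrace h β f y₀ + δ * hessianTrace h β s y₀) (𝓝[>] 0)
      (𝓝 (hessianTrace h β f y₀ + 0 * hessianTrace h β s y₀)) :=
    tendsto_nhdsWithin_of_tendsto_nhds
      ((continuous_const.add (continuous_id.mul continuous_const)).tendsto 0)
  simpa using ge_of_tendsto hlim (eventually_mem_nhdsWithin.mono hnonneg)

end LocalRestriction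

section ModelSpaces

variable {F : Type*} [NormedAddCommGroup F] [NormedSpace ℝ F]
  {X : Type*} [TopologicalSpace X] [ChartedSpace F X]
  {E : Type*} [NormedAddCommGroup E] [NormedSpace ℝ E]
  {Z : Type*} [TopologicalSpace Z] [ChartedSpace E Z]
  {G : Type*} [NormedAddCommGroup G] [NormedSpace ℝ G]
  {Y : Type*} [TopologicalSpace Y] [ChartedSpace G Y]

variable (F E) in
/-- The differential of `f` at `x`, as a map between the model spaces, to which the tangent spaces
are definitionally equal. -/
def modelDeriv (f : X → Z) (x : X) : F →L[ℝ] E :=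
  mfderiv 𝓘(ℝ, F) 𝓘(ℝ, E) f x

/-- The value at `z` of a field of bilinear forms, as a form on the model space. -/
def modelForm (g : BilinearField E Z) (z : Z) : E →L[ℝ] E →L[ℝ] ℝ := g z

/-- The expression of a field of bilinear forms on `Z` in the parametrization `f`. -/
def localMetric (g : BilinearField E Z) (f : F → Z) (y : F) : F →L[ℝ] F →L[ℝ] ℝ :=
  pullbackMetric (F := F) (X := F) f g y

theorem localMetric_eq_bilinearComp (g : BilinearField E Z) (f : F → Z) (y : F) :
    localMetric g f y =
      (modelForm g (f y)).bilinearComp (modelDeriv F E f y) (modelDeriv F E f y) := rfl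

theorem modelForm_pullbackMetric (g : BilinearField E Z) (f : X → Z) (x : X) :
    modelForm (pullbackMetric (F := F) f g) x =
      (modelForm g (f x)).bilinearComp (modelDeriv F E f x) (modelDeriv F E f x) := rfl

theorem modelDeriv_comp {f : X → Z} {c : Y → X} {y : Y}
    (hf : MDifferentiableAt 𝓘(ℝ, F) 𝓘(ℝ, E) f (c y))
    (hc : MDifferentiableAt 𝓘(ℝ, G) 𝓘(ℝ, F) c y) :
    modelDeriv G E (f ∘ c) y = modelDeriv F E f (c y) ∘L modelDeriv G F c y :=
  mfderiv_comp y hf hc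

theorem modelDeriv_congr {f f' : X → Z} {x : X} (h : f =ᶠ[𝓝 x] f') :
    modelDeriv F E f x = modelDeriv F E f' x :=
  h.mfderiv_eq

theorem modelDeriv_eq_fderiv (f : F → E) (y : F) : modelDeriv F E f y = fderiv ℝ f y :=
  mfderiv_eq_fderiv

theorem modelDeriv_id (z : Z) : modelDeriv E E (id : Z → Z) z = .id ℝ E :=
  mfderiv_id

theorem pullbackMetric_id (g : BilinearField E Z) : pullbackMetric (F := E) id g = g := by
  funext z
  change (modelForm g z).bilinearComp (modelDeriv E E id z) (modelDeriv E E id z) = modelForm g z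
  rw [modelDeriv_id]
  rfl

end ModelSpaces

section Charts

variable {F : Type*} [NormedAddCommGroup F] [NormedSpace ℝ F]
  {X : Type*} [TopologicalSpace X] [ChartedSpace F X]
  {E : Type*} [NormedAddCommGroup E] [NormedSpace ℝ E]
  {Z : Type*} [TopologicalSpace Z] [ChartedSpace E Z]
  {χ : OpenPartialHomeomorph Z E} {ψ : OpenPartialHomeomorph X F}

theorem mdifferentiableAt_chart (hχ : χ ∈ IsManifold.maximalAtlas 𝓘(ℝ, E) ∞ Z) {z : Z}
    (hz : z ∈ χ.source) : MDifferentiableAt 𝓘(ℝ, E) 𝓘(ℝ, E) χ z :=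
  (contMDiffAt_of_mem_maximalAtlas hχ hz).mdifferentiableAt (by simp)

theorem mdifferentiableAt_chart_symm (hχ : χ ∈ IsManifold.maximalAtlas 𝓘(ℝ, E) ∞ Z) {z : Z}
    (hz : z ∈ χ.source) : MDifferentiableAt 𝓘(ℝ, E) 𝓘(ℝ, E) χ.symm (χ z) :=
  (contMDiffAt_symm_of_mem_maximalAtlas hχ (χ.map_source hz)).mdifferentiableAt (by simp)

theorem modelDeriv_chart_comp_symm (hχ : χ ∈ IsManifold.maximalAtlas 𝓘(ℝ, E) ∞ Z) {z : Z}
    (hz : z ∈ χ.source) : modelDeriv E E χ z ∘L modelDeriv E E χ.symm (χ z) = .id ℝ E := by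
  have hid : (χ ∘ χ.symm : E → E) =ᶠ[𝓝 (χ z)] id :=
    Filter.eventuallyEq_of_mem (χ.open_target.mem_nhds (χ.map_source hz)) fun _ => χ.right_inv
  have hcomp := modelDeriv_comp (by rw [χ.left_inv hz]; exact mdifferentiableAt_chart hχ hz)
    (mdifferentiableAt_chart_symm hχ hz)
  rw [modelDeriv_congr hid, modelDeriv_id, χ.left_inv hz] at hcomp
  exact hcomp.symm

theorem modelDeriv_symm_comp_chart (hχ : χ ∈ IsManifold.maximalAtlas 𝓘(ℝ, E) ∞ Z) {z : Z}
    (hz : z ∈ χ.source) : modelDeriv E E χ.symm (χ z) ∘L modelDeriv E E χ z = .id ℝ E := by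
  have hid : (χ.symm ∘ χ : Z → Z) =ᶠ[𝓝 z] id :=
    Filter.eventuallyEq_of_mem (χ.open_source.mem_nhds hz) fun _ => χ.left_inv
  have hcomp := modelDeriv_comp (mdifferentiableAt_chart_symm hχ hz)
    (mdifferentiableAt_chart hχ hz)
  rw [modelDeriv_congr hid, modelDeriv_id] at hcomp
  exact hcomp.symm

theorem injective_modelDeriv_chart (hχ : χ ∈ IsManifold.maximalAtlas 𝓘(ℝ, E) ∞ Z) {z : Z}
    (hz : z ∈ χ.source) : Function.Injective (modelDeriv E E χ z) :=
  Function.LeftInverse.injective fun v => DFunLike.congr_fun (modelDeriv_symm_comp_chart hχ hz) v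

theorem injective_modelDeriv_chart_symm (hχ : χ ∈ IsManifold.maximalAtlas 𝓘(ℝ, E) ∞ Z) {z : Z}
    (hz : z ∈ χ.source) : Function.Injective (modelDeriv E E χ.symm (χ z)) :=
  Function.LeftInverse.injective fun v => DFunLike.congr_fun (modelDeriv_chart_comp_symm hχ hz) v

variable [IsManifold 𝓘(ℝ, E) ∞ Z]

theorem contMDiffOn_tangentMap [IsManifold 𝓘(ℝ, F) ∞ X] {f : X → Z} {s : Set X} (hs : IsOpen s)
    (hf : ContMDiffOn 𝓘(ℝ, F) 𝓘(ℝ, E) ∞ f s) :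
    ContMDiffOn 𝓘(ℝ, F).tangent 𝓘(ℝ, E).tangent ∞ (tangentMap 𝓘(ℝ, F) 𝓘(ℝ, E) f)
      (TotalSpace.proj ⁻¹' s) :=
  (hf.contMDiffOn_tangentMapWithin (m := ∞) (by simp) hs.uniqueMDiffOn).congr fun v hv => by
    rw [tangentMap, tangentMapWithin, mfderivWithin_of_isOpen hs hv]

theorem contDiffOn_localMetric [FiniteDimensional ℝ F]
    (g : ContMDiffRiemannianMetric 𝓘(ℝ, E) ∞ E (fun z : Z => TangentSpace 𝓘(ℝ, E) z))
    {f : F → Z} {s : Set F} (hs : IsOpen s) (hf : ContMDiffOn 𝓘(ℝ, F) 𝓘(ℝ, E) ∞ f s) :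
    ContDiffOn ℝ ∞ (localMetric g.inner f) s := by
  have hDf (v : F) : ContMDiffOn 𝓘(ℝ, F) 𝓘(ℝ, E).tangent ∞
      (fun y => (⟨f y, modelDeriv F E f y v⟩ : TangentBundle 𝓘(ℝ, E) Z)) s :=
    have hv : ContMDiff 𝓘(ℝ, F) 𝓘(ℝ, F).tangent ∞
        (fun y : F => (⟨y, v⟩ : TangentBundle 𝓘(ℝ, F) F)) := fun _ =>
      contMDiffAt_vectorSpace_iff_contDiffAt.2 contDiffAt_const
    (contMDiffOn_tangentMap hs hf).comp hv.contMDiffOn fun _ hy => hy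
  refine contDiffOn_clm_apply.2 fun v => contDiffOn_clm_apply.2 fun w y hy => ?_
  have happly := ContMDiffOn.clm_bundle_apply₂ (F₁ := E) (F₂ := E) (F₃ := ℝ)
    (E₃ := Bundle.Trivial Z ℝ) (g.contMDiff.comp_contMDiffOn hf) (hDf v) (hDf w) y hy
  rw [contMDiffWithinAt_totalSpace] at happly
  exact happly.2.contDiffWithinAt

variable (g : ContMDiffRiemannianMetric 𝓘(ℝ, E) ∞ E (fun z : Z => TangentSpace 𝓘(ℝ, E) z))

theorem contDiffAt_localMetric_chart [FiniteDimensional ℝ E]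
    (hχ : χ ∈ IsManifold.maximalAtlas 𝓘(ℝ, E) ∞ Z) {z : Z} (hz : z ∈ χ.source) :
    ContDiffAt ℝ ∞ (localMetric g.inner χ.symm) (χ z) :=
  (contDiffOn_localMetric g χ.open_target (contMDiffOn_symm_of_mem_maximalAtlas hχ)).contDiffAt
    (χ.open_target.mem_nhds (χ.map_source hz))

theorem isInnerProduct_modelForm (z : Z) : IsInnerProduct (modelForm g.inner z) where
  symm _ _ := g.symm _ _ _
  pos _ hv := g.pos _ _ hv

theorem isInnerProduct_localMetric_chart (hχ : χ ∈ IsManifold.maximalAtlas 𝓘(ℝ, E) ∞ Z) {z : Z}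
    (hz : z ∈ χ.source) : IsInnerProduct (localMetric g.inner χ.symm (χ z)) :=
  (isInnerProduct_modelForm g _).bilinearComp (injective_modelDeriv_chart_symm hχ hz)

end Charts

section Pullback

variable {F : Type*} [NormedAddCommGroup F] [NormedSpace ℝ F]
  {X : Type*} [TopologicalSpace X] [ChartedSpace F X]
  {E : Type*} [NormedAddCommGroup E] [NormedSpace ℝ E]
  {Z : Type*} [TopologicalSpace Z] [ChartedSpace E Z]
  {χ : OpenPartialHomeomorph Z E} {ψ : OpenPartialHomeomorph X F} {i : X → Z} {x : X}

theorem contDiffAt_comp_chart_symm (hψ : ψ ∈ IsManifold.maximalAtlas 𝓘(ℝ, F) ∞ X)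
    (hx : x ∈ ψ.source) {φ : X → ℝ} (hφ : ContMDiffAt 𝓘(ℝ, F) 𝓘(ℝ, ℝ) 2 φ x) :
    ContDiffAt ℝ 2 (φ ∘ ψ.symm) (ψ x) :=
  (ContMDiffAt.comp _ (by rwa [ψ.left_inv hx]) ((contMDiffAt_symm_of_mem_maximalAtlas hψ
    (ψ.map_source hx)).of_le ENat.LEInfty.out)).contDiffAt

theorem contDiffAt_chart_comp_symm (hψ : ψ ∈ IsManifold.maximalAtlas 𝓘(ℝ, F) ∞ X)
    (hχ : χ ∈ IsManifold.maximalAtlas 𝓘(ℝ, E) ∞ Z) (hx : x ∈ ψ.source) (hix : i x ∈ χ.source)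
    (hi : ContMDiffAt 𝓘(ℝ, F) 𝓘(ℝ, E) ∞ i x) : ContDiffAt ℝ ∞ (χ ∘ i ∘ ψ.symm) (ψ x) := by
  have hψx : ψ.symm (ψ x) = x := ψ.left_inv hx
  have hiψ : ContMDiffAt 𝓘(ℝ, F) 𝓘(ℝ, E) ∞ (i ∘ ψ.symm) (ψ x) :=
    .comp _ (by rwa [hψx]) (contMDiffAt_symm_of_mem_maximalAtlas hψ (ψ.map_source hx))
  exact (ContMDiffAt.comp _ (contMDiffAt_of_mem_maximalAtlas hχ (by simpa [hψx])) hiψ).contDiffAt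

theorem fderiv_chart_comp_symm (hψ : ψ ∈ IsManifold.maximalAtlas 𝓘(ℝ, F) ∞ X)
    (hχ : χ ∈ IsManifold.maximalAtlas 𝓘(ℝ, E) ∞ Z) (hx : x ∈ ψ.source) (hix : i x ∈ χ.source)
    (hi : MDifferentiableAt 𝓘(ℝ, F) 𝓘(ℝ, E) i x) :
    fderiv ℝ (χ ∘ i ∘ ψ.symm) (ψ x) =
      modelDeriv E E χ (i x) ∘L modelDeriv F E i x ∘L modelDeriv F F ψ.symm (ψ x) := by
  have hψx : ψ.symm (ψ x) = x := ψ.left_inv hx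
  have hψ' := mdifferentiableAt_chart_symm hψ hx
  have hi' : MDifferentiableAt 𝓘(ℝ, F) 𝓘(ℝ, E) i (ψ.symm (ψ x)) := by rwa [hψx]
  rw [← modelDeriv_eq_fderiv, modelDeriv_comp (by simpa [hψx] using mdifferentiableAt_chart hχ hix)
    (hi'.comp _ hψ'), modelDeriv_comp hi' hψ', Function.comp_apply, hψx]

theorem fderiv_chart_comp_symm_apply (hψ : ψ ∈ IsManifold.maximalAtlas 𝓘(ℝ, F) ∞ X)
    (hχ : χ ∈ IsManifold.maximalAtlas 𝓘(ℝ, E) ∞ Z) (hx : x ∈ ψ.source) (hix : i x ∈ χ.source)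
    (hi : MDifferentiableAt 𝓘(ℝ, F) 𝓘(ℝ, E) i x) (v : F) :
    fderiv ℝ (χ ∘ i ∘ ψ.symm) (ψ x) (modelDeriv F F ψ x v) =
      modelDeriv E E χ (i x) (modelDeriv F E i x v) := by
  have hv := DFunLike.congr_fun (modelDeriv_symm_comp_chart hψ hx) v
  simp only [ContinuousLinearMap.comp_apply, ContinuousLinearMap.id_apply] at hv
  simp only [fderiv_chart_comp_symm hψ hχ hx hix hi, ContinuousLinearMap.comp_apply, hv]

theorem localMetric_pullbackMetric (hψ : ψ ∈ IsManifold.maximalAtlas 𝓘(ℝ, F) ∞ X)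
    (hχ : χ ∈ IsManifold.maximalAtlas 𝓘(ℝ, E) ∞ Z) (hx : x ∈ ψ.source) (hix : i x ∈ χ.source)
    (hi : MDifferentiableAt 𝓘(ℝ, F) 𝓘(ℝ, E) i x) (g : BilinearField E Z) :
    localMetric (pullbackMetric (F := F) i g) ψ.symm (ψ x) =
      (localMetric g χ.symm (χ (i x))).bilinearComp
        (fderiv ℝ (χ ∘ i ∘ ψ.symm) (ψ x)) (fderiv ℝ (χ ∘ i ∘ ψ.symm) (ψ x)) := by
  have hχD (v : E) : modelDeriv E E χ.symm (χ (i x)) (modelDeriv E E χ (i x) v) = v :=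
    DFunLike.congr_fun (modelDeriv_symm_comp_chart hχ hix) v
  rw [localMetric_eq_bilinearComp, modelForm_pullbackMetric]
  ext v w
  simp only [localMetric_eq_bilinearComp, ψ.left_inv hx, χ.left_inv hix,
    fderiv_chart_comp_symm hψ hχ hx hix hi, ContinuousLinearMap.bilinearComp_apply,
    ContinuousLinearMap.comp_apply, hχD]

theorem hessian_eq_localHessian_chartAt (g : BilinearField E Z) (φ : Z → ℝ) (z : Z) (v w : E) :
    hessian g φ z v w = localHessian (localMetric g (chartAt E z).symm) (φ ∘ (chartAt E z).symm)
      (chartAt E z z) (modelDeriv E E (chartAt E z) z v) (modelDeriv E E (chartAt E z) z w) :=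
  (localHessian_apply ..).symm

theorem sum_secondCovDeriv_mem_range (g : BilinearField E Z) [IsManifold 𝓘(ℝ, F) ∞ X]
    [IsManifold 𝓘(ℝ, E) ∞ Z] (hi : MDifferentiableAt 𝓘(ℝ, F) 𝓘(ℝ, E) i x)
    {ι : Type*} [Fintype ι] {v w : ι → F}
    (hB : ∑ j, secondFundamentalForm (F := F) g i x (v j) (w j) = 0) :
    ∑ j, secondCovDeriv (localMetric g (chartAt E (i x)).symm)
        (chartAt E (i x) ∘ i ∘ (chartAt F x).symm) (chartAt F x x)
        (modelDeriv F F (chartAt F x) x (v j)) (modelDeriv F F (chartAt F x) x (w j)) ∈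
      (fderiv ℝ (chartAt E (i x) ∘ i ∘ (chartAt F x).symm) (chartAt F x x)).range := by
  set χ := chartAt E (i x)
  set ψ := chartAt F x
  set a : ι → E := fun j => secondCovDeriv (localMetric g χ.symm) (χ ∘ i ∘ ψ.symm) (ψ x)
    (modelDeriv F F ψ x (v j)) (modelDeriv F F ψ x (w j))
  have hψ : ψ ∈ IsManifold.maximalAtlas 𝓘(ℝ, F) ∞ X := IsManifold.chart_mem_maximalAtlas x
  have hχ : χ ∈ IsManifold.maximalAtlas 𝓘(ℝ, E) ∞ Z := IsManifold.chart_mem_maximalAtlas (i x)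
  have hx : x ∈ ψ.source := mem_chart_source F x
  have hix : i x ∈ χ.source := mem_chart_source E (i x)
  have hcx : (χ ∘ i ∘ ψ.symm) (ψ x) = χ (i x) := by simp [ψ.left_inv hx]
  have hnormal (j : ι) : ∃ t : F, (secondFundamentalForm (F := F) g i x (v j) (w j) : E) =
      modelDeriv E E χ.symm (χ (i x)) (a j) - modelDeriv F E i x t := by
    simp only [a, secondCovDeriv, hcx]
    exact ⟨_, rfl⟩
  choose t ht using hnormal
  have hsum : modelDeriv E E χ.symm (χ (i x)) (∑ j, a j) = modelDeriv F E i x (∑ j, t j) := by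
    rw [map_sum, map_sum, ← sub_eq_zero, ← Finset.sum_sub_distrib]
    exact (Finset.sum_congr rfl fun j _ => (ht j).symm).trans hB
  refine ⟨modelDeriv F F ψ x (∑ j, t j), ?_⟩
  rw [ContinuousLinearMap.coe_coe, fderiv_chart_comp_symm_apply hψ hχ hx hix hi, ← hsum]
  exact DFunLike.congr_fun (modelDeriv_chart_comp_symm hχ hix) (∑ j, a j)

variable [FiniteDimensional ℝ F] [FiniteDimensional ℝ E] [IsManifold 𝓘(ℝ, E) ∞ Z]
  (g : ContMDiffRiemannianMetric 𝓘(ℝ, E) ∞ E (fun z : Z => TangentSpace 𝓘(ℝ, E) z))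

theorem sum_localHessian_pullbackMetric (hψ : ψ ∈ IsManifold.maximalAtlas 𝓘(ℝ, F) ∞ X)
    (hχ : χ ∈ IsManifold.maximalAtlas 𝓘(ℝ, E) ∞ Z) (hx : x ∈ ψ.source) (hix : i x ∈ χ.source)
    (hi : ContMDiff 𝓘(ℝ, F) 𝓘(ℝ, E) ∞ i) (hinj : Function.Injective (modelDeriv F E i x))
    {f : E → ℝ} (hf : ContDiffAt ℝ 2 f (χ (i x))) {ι : Type*} [Fintype ι] (v w : ι → F)
    (htan : ∑ j, secondCovDeriv (localMetric g.inner χ.symm) (χ ∘ i ∘ ψ.symm) (ψ x)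
        (modelDeriv F F ψ x (v j)) (modelDeriv F F ψ x (w j)) ∈
      (fderiv ℝ (χ ∘ i ∘ ψ.symm) (ψ x)).range) :
    ∑ j, localHessian (localMetric (pullbackMetric (F := F) i g.inner) ψ.symm)
        (f ∘ χ ∘ i ∘ ψ.symm) (ψ x) (modelDeriv F F ψ x (v j)) (modelDeriv F F ψ x (w j)) =
      ∑ j, localHessian (localMetric g.inner χ.symm) f (χ (i x))
        (modelDeriv E E χ (i x) (modelDeriv F E i x (v j)))
        (modelDeriv E E χ (i x) (modelDeriv F E i x (w j))) := by
  have hcx : (χ ∘ i ∘ ψ.symm) (ψ x) = χ (i x) := by simp [ψ.left_inv hx]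
  have hi' (x' : X) : MDifferentiableAt 𝓘(ℝ, F) 𝓘(ℝ, E) i x' := hi.mdifferentiable (by simp) x'
  have hmetric : localMetric (pullbackMetric (F := F) i g.inner) ψ.symm =ᶠ[𝓝 (ψ x)] fun y =>
      (localMetric g.inner χ.symm ((χ ∘ i ∘ ψ.symm) y)).bilinearComp
        (fderiv ℝ (χ ∘ i ∘ ψ.symm) y) (fderiv ℝ (χ ∘ i ∘ ψ.symm) y) := by
    refine (ψ.eventually_nhds _ hx).2 ?_
    filter_upwards [ψ.open_source.mem_nhds hx, hi.continuous.continuousAt.eventually_mem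
      (χ.open_source.mem_nhds hix)] with x' hx' hix'
    rw [localMetric_pullbackMetric hψ hχ hx' hix' (hi' x'), Function.comp_apply,
      Function.comp_apply, ψ.left_inv hx']
  have hinj' : Function.Injective (fderiv ℝ (χ ∘ i ∘ ψ.symm) (ψ x)) := by
    rw [fderiv_chart_comp_symm hψ hχ hx hix (hi' x)]
    exact (injective_modelDeriv_chart hχ hix).comp
      (hinj.comp (injective_modelDeriv_chart_symm hψ hx))
  have hsum := sum_localHessian_comp
    ((contDiffAt_chart_comp_symm hψ hχ hx hix hi.contMDiffAt).of_le ENat.LEInfty.out)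
    (hcx ▸ (contDiffAt_localMetric_chart g hχ hix).of_le ENat.LEInfty.out)
    hmetric (hcx ▸ isInnerProduct_localMetric_chart g hχ hix) hinj' (hcx ▸ hf) _ _ htan
  simpa only [fderiv_chart_comp_symm_apply hψ hχ hx hix (hi' x), hcx] using hsum

theorem hessian_comp_chart {z : Z} (hχ : χ ∈ IsManifold.maximalAtlas 𝓘(ℝ, E) ∞ Z)
    (hz : z ∈ χ.source) {f : E → ℝ} (hf : ContDiffAt ℝ 2 f (χ z)) (v w : E) :
    hessian g.inner (f ∘ χ) z v w = localHessian (localMetric g.inner χ.symm) f (χ z)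
      (modelDeriv E E χ z v) (modelDeriv E E χ z w) := by
  have hψ := IsManifold.chart_mem_maximalAtlas (I := 𝓘(ℝ, E)) (n := ∞) z
  have hψz := mem_chart_source E z
  have hinj : Function.Injective (modelDeriv E E id z) := by
    rw [modelDeriv_id]; exact Function.injective_id
  have hrange : (fderiv ℝ (χ ∘ id ∘ (chartAt E z).symm) (chartAt E z z)).range = ⊤ := by
    rw [fderiv_chart_comp_symm hψ hχ hψz hz mdifferentiableAt_id]
    exact LinearMap.range_eq_top.2 (LinearMap.injective_iff_surjective.1
      ((injective_modelDeriv_chart hχ hz).comp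
        (hinj.comp (injective_modelDeriv_chart_symm hψ hψz))))
  have hsum := sum_localHessian_pullbackMetric g hψ hχ hψz hz contMDiff_id hinj hf
    (fun _ : Unit => v) (fun _ => w) (hrange ▸ Submodule.mem_top)
  simp only [pullbackMetric_id, modelDeriv_id, Finset.univ_unique, Finset.sum_singleton,
    ContinuousLinearMap.id_apply] at hsum
  exact (hessian_eq_localHessian_chartAt ..).trans hsum

theorem sum_hessian_comp [IsManifold 𝓘(ℝ, F) ∞ X] (hi : ContMDiff 𝓘(ℝ, F) 𝓘(ℝ, E) ∞ i)
    (hinj : Function.Injective (modelDeriv F E i x)) {ι : Type*} [Fintype ι] {v w : ι → F}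
    (hB : ∑ j, secondFundamentalForm (F := F) g.inner i x (v j) (w j) = 0)
    {φ : Z → ℝ} (hφ : ContMDiffAt 𝓘(ℝ, E) 𝓘(ℝ, ℝ) 2 φ (i x)) :
    ∑ j, hessian (pullbackMetric (F := F) i g.inner) (φ ∘ i) x (v j) (w j) =
      ∑ j, hessian g.inner φ (i x) (modelDeriv F E i x (v j)) (modelDeriv F E i x (w j)) := by
  have hψ := IsManifold.chart_mem_maximalAtlas (I := 𝓘(ℝ, F)) (n := ∞) x
  have hχ := IsManifold.chart_mem_maximalAtlas (I := 𝓘(ℝ, E)) (n := ∞) (i x)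
  have hx := mem_chart_source F x
  have hix := mem_chart_source E (i x)
  have hi' : MDifferentiableAt 𝓘(ℝ, F) 𝓘(ℝ, E) i x := hi.mdifferentiable (by simp) x
  have hφi : φ ∘ i ∘ (chartAt F x).symm =ᶠ[𝓝 (chartAt F x x)]
      (φ ∘ (chartAt E (i x)).symm) ∘ chartAt E (i x) ∘ i ∘ (chartAt F x).symm := by
    refine ((chartAt F x).eventually_nhds' (fun x' => φ (i x') =
      φ ((chartAt E (i x)).symm (chartAt E (i x) (i x')))) hx).2 ?_
    filter_upwards [hi.continuous.continuousAt.eventually_mem (chart_source_mem_nhds E (i x))]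
      with x' hx'
    rw [(chartAt E (i x)).left_inv hx']
  have hsum := sum_localHessian_pullbackMetric g hψ hχ hx hix hi hinj
    (contDiffAt_comp_chart_symm hχ hix hφ) v w (sum_secondCovDeriv_mem_range g.inner hi' hB)
  rw [← localHessian_congr hφi] at hsum
  simp only [hessian_eq_localHessian_chartAt]
  exact hsum

end Pullback

section Frames

variable {F : Type*} [NormedAddCommGroup F] [NormedSpace ℝ F]
  {X : Type*} [TopologicalSpace X] [ChartedSpace F X]
  {E : Type*} [NormedAddCommGroup E] [NormedSpace ℝ E]
  {Z : Type*} [TopologicalSpace Z] [ChartedSpace E Z]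
  {p : ℕ} {χ : OpenPartialHomeomorph Z E} {ξ : TangentPlane E Z p} {A : Tuples E Z p} {z : Z}

/-- A tangent plane, as a subspace of the model space. -/
def TangentPlane.modelPlane (ξ : TangentPlane E Z p) : Submodule ℝ E := ξ.plane

/-- A tuple of tangent vectors, as a tuple of vectors of the model space. -/
def modelTuple (A : Tuples E Z p) : EuclideanSpace ℝ (Fin p) →L[ℝ] E := A.2

/-- The image of a tangent plane under the differential of a chart. -/
def chartPlane (χ : OpenPartialHomeomorph Z E) (ξ : TangentPlane E Z p) : Submodule ℝ E :=
  ξ.modelPlane.map (modelDeriv E E χ ξ.base).toLinearMap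

/-- The image of a tuple of tangent vectors under the differential of a chart. -/
def chartTuple (χ : OpenPartialHomeomorph Z E) (A : Tuples E Z p) :
    EuclideanSpace ℝ (Fin p) →L[ℝ] E :=
  modelDeriv E E χ A.1 ∘L modelTuple A

/-- The tuple of tangent vectors that is given in the chart `χ` by the tuple `L` at `y`. -/
def tupleOfChart (χ : OpenPartialHomeomorph Z E) (y : E) (L : EuclideanSpace ℝ (Fin p) →L[ℝ] E) :
    Tuples E Z p :=
  ⟨χ.symm y, modelDeriv E E χ.symm y ∘L L⟩

theorem TangentPlane.ext_modelPlane {ξ' : TangentPlane E Z p} (hbase : ξ.base = ξ'.base)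
    (hplane : ξ.modelPlane = ξ'.modelPlane) : ξ = ξ' := by
  obtain ⟨z, W, hW⟩ := ξ
  obtain ⟨z', W', hW'⟩ := ξ'
  obtain rfl : z = z' := hbase
  obtain rfl : W = W' := hplane
  rfl

theorem isFrameOf_iff :
    IsFrameOf A ξ ↔ A.1 = ξ.base ∧ (modelTuple A).range = ξ.modelPlane := by
  refine ⟨?_, fun ⟨hbase, hrange⟩ => ⟨?_, TangentPlane.ext_modelPlane hbase hrange⟩⟩
  · rintro ⟨hA, rfl⟩
    exact ⟨rfl, rfl⟩
  · have hrank := (modelTuple A).toLinearMap.finrank_range_add_finrank_ker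
    rw [hrange, finrank_euclideanSpace_fin] at hrank
    have hker : finrank ℝ (modelTuple A).ker = 0 := by
      have hξ : finrank ℝ ξ.modelPlane = p := ξ.finrank_eq
      omega
    exact LinearMap.ker_eq_bot.1 (Submodule.finrank_eq_zero.1 hker)

theorem IsFrameOf.base_eq (h : IsFrameOf A ξ) : A.1 = ξ.base := (isFrameOf_iff.1 h).1

theorem IsFrameOf.range_chartTuple (h : IsFrameOf A ξ) :
    (chartTuple χ A).range = chartPlane χ ξ := by
  obtain ⟨hbase, hrange⟩ := isFrameOf_iff.1 h
  rw [chartPlane, ← hrange, ← hbase]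
  exact LinearMap.range_comp _ _

theorem isFrameOf_tupleOfChart_iff (hχ : χ ∈ IsManifold.maximalAtlas 𝓘(ℝ, E) ∞ Z)
    (hz : z ∈ χ.source) {L : EuclideanSpace ℝ (Fin p) →L[ℝ] E} :
    IsFrameOf (tupleOfChart χ (χ z) L) ξ ↔ ξ.base = z ∧ chartPlane χ ξ = L.range := by
  have hD : chartTuple χ (tupleOfChart χ (χ z) L) = L := by
    change modelDeriv E E χ (χ.symm (χ z)) ∘L (modelDeriv E E χ.symm (χ z) ∘L L) = L
    rw [χ.left_inv hz, ← ContinuousLinearMap.comp_assoc, modelDeriv_chart_comp_symm hχ hz,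
      ContinuousLinearMap.id_comp]
  refine ⟨fun h => ⟨h.base_eq.symm.trans (χ.left_inv hz), by rw [← h.range_chartTuple, hD]⟩, ?_⟩
  rintro ⟨rfl, hplane⟩
  refine isFrameOf_iff.2 ⟨χ.left_inv hz, ?_⟩
  have hrange : (modelTuple (tupleOfChart χ (χ ξ.base) L)).range =
      L.range.map (modelDeriv E E χ.symm (χ ξ.base)).toLinearMap := LinearMap.range_comp _ _
  rw [hrange, ← hplane, chartPlane, ← Submodule.map_comp]
  convert Submodule.map_id _
  exact congrArg ContinuousLinearMap.toLinearMap (modelDeriv_symm_comp_chart hχ hz)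

theorem contDiffAt_clm_of_apply {G H : Type*} [NormedAddCommGroup G] [NormedSpace ℝ G]
    [FiniteDimensional ℝ G] [NormedAddCommGroup H] [NormedSpace ℝ H] {n : WithTop ℕ∞}
    {f : E → G →L[ℝ] H} {y : E} (h : ∀ v, ContDiffAt ℝ n (fun y => f y v) y) :
    ContDiffAt ℝ n f y := by
  let b := Module.finBasis ℝ G
  have hf : f = fun y => ∑ j, (b.coord j).toContinuousLinearMap.smulRight (f y (b j)) := by
    ext y v
    conv_lhs => rw [← b.sum_repr v, map_sum]
    simp
  rw [hf]
  exact ContDiffAt.sum fun j _ => contDiffAt_const.smulRight (h (b j))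

variable [IsManifold 𝓘(ℝ, E) ∞ Z]

theorem contDiffAt_chartTuple (hχ : χ ∈ IsManifold.maximalAtlas 𝓘(ℝ, E) ∞ Z)
    {G : Type*} [NormedAddCommGroup G] [NormedSpace ℝ G] {B : G → Tuples E Z p} {y : G}
    (hB : ContMDiffAt 𝓘(ℝ, G) (𝓘(ℝ, E).prod 𝓘(ℝ, EuclideanSpace ℝ (Fin p) →L[ℝ] E)) ∞ B y)
    (hy : (B y).1 ∈ χ.source) : ContDiffAt ℝ ∞ (fun y => chartTuple χ (B y)) y := by
  refine contDiffAt_clm_of_apply fun v => ?_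
  have hv : ContMDiffAt 𝓘(ℝ, G) (𝓘(ℝ, E).prod 𝓘(ℝ, EuclideanSpace ℝ (Fin p))) ∞
      (fun y => TotalSpace.mk' (EuclideanSpace ℝ (Fin p))
        (E := Bundle.Trivial Z (EuclideanSpace ℝ (Fin p))) (B y).1 v) y :=
    contMDiffAt_totalSpace.2 ⟨(contMDiffAt_totalSpace.1 hB).1, contMDiffAt_const⟩
  have hBv := ContMDiffAt.clm_bundle_apply (F₁ := EuclideanSpace ℝ (Fin p)) (F₂ := E)
    (E₁ := Bundle.Trivial Z (EuclideanSpace ℝ (Fin p)))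
    (E₂ := fun z : Z => TangentSpace 𝓘(ℝ, E) z) (ϕ := fun y => (B y).2) hB hv
  have hDχ := (contMDiffOn_tangentMap χ.open_source
    (contMDiffOn_of_mem_maximalAtlas hχ)).contMDiffAt (x := ⟨(B y).1, (B y).2 v⟩)
    ((χ.open_source.preimage
      (FiberBundle.continuous_proj E (TangentSpace 𝓘(ℝ, E) (M := Z)))).mem_nhds hy)
  exact ((contMDiff_snd_tangentBundle_modelSpace E 𝓘(ℝ, E) (n := ∞)).contMDiffAt.comp y
    (hDχ.comp y hBv)).contDiffAt

theorem contMDiffAt_tupleOfChart (hχ : χ ∈ IsManifold.maximalAtlas 𝓘(ℝ, E) ∞ Z)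
    {L : E → EuclideanSpace ℝ (Fin p) →L[ℝ] E} {y : E} (hy : y ∈ χ.target)
    (hL : ContDiffAt ℝ ∞ L y) :
    ContMDiffAt 𝓘(ℝ, E) (𝓘(ℝ, E).prod 𝓘(ℝ, EuclideanSpace ℝ (Fin p) →L[ℝ] E)) ∞
      (fun y => tupleOfChart χ y (L y)) y := by
  have hχy := contMDiffAt_symm_of_mem_maximalAtlas hχ hy
  refine (contMDiffAt_hom_bundle _).2 ⟨hχy,
    (contDiffAt_clm_of_apply fun v => ?_ : ContDiffAt ℝ ∞ _ y).contMDiffAt⟩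
  have hLv : ContMDiffAt 𝓘(ℝ, E) 𝓘(ℝ, E).tangent ∞
      (fun y => (⟨y, L y v⟩ : TangentBundle 𝓘(ℝ, E) E)) y :=
    contMDiffAt_vectorSpace_iff_contDiffAt.2 (hL.clm_apply contDiffAt_const)
  have hDχ := (contMDiffOn_tangentMap χ.open_target
    (contMDiffOn_symm_of_mem_maximalAtlas hχ)).contMDiffAt (x := ⟨y, L y v⟩)
    ((χ.open_target.preimage
      (FiberBundle.continuous_proj E (TangentSpace 𝓘(ℝ, E) (M := E)))).mem_nhds hy)
  refine (contMDiffAt_totalSpace.1 (hDχ.comp y hLv)).2.contDiffAt.congr_of_eventuallyEq ?_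
  set t := trivializationAt E (fun z : Z => TangentSpace 𝓘(ℝ, E) z) (χ.symm y)
  filter_upwards [hχy.continuousAt.eventually_mem
    (t.open_baseSet.mem_nhds (FiberBundle.mem_baseSet_trivializationAt' _))] with y' hy'
  have htriv : (trivializationAt (EuclideanSpace ℝ (Fin p))
      (Bundle.Trivial Z (EuclideanSpace ℝ (Fin p))) (χ.symm y)).symmL ℝ (χ.symm y') v = v := by
    change (Bundle.Trivial.trivialization Z (EuclideanSpace ℝ (Fin p))).symmL ℝ (χ.symm y') v = v
    rw [Bundle.Trivial.symmL_trivialization]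
    rfl
  exact (congrFun (t.coe_linearMapAt_of_mem (R := ℝ) hy') _).trans
    (congrArg (fun w => (t ⟨χ.symm y', modelDeriv E E χ.symm y' (L y' w)⟩).2) htriv)

end Frames

section Extension

variable {E : Type*} [NormedAddCommGroup E] [NormedSpace ℝ E]
  {Z : Type*} [TopologicalSpace Z] [ChartedSpace E Z] [IsManifold 𝓘(ℝ, E) ∞ Z]
  {p : ℕ} {χ : OpenPartialHomeomorph Z E} {𝒢 N : Set (TangentPlane E Z p)}
  {ξ₀ : TangentPlane E Z p} {A₀ : Tuples E Z p}

theorem eventually_mem_of_isFrameOf (hN : IsOpen N) (hξ₀ : ξ₀ ∈ N) (hA₀ : IsFrameOf A₀ ξ₀) :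
    ∀ᶠ A in 𝓝 A₀, ∀ ξ, IsFrameOf A ξ → ξ ∈ N := by
  obtain ⟨O, hO, hON⟩ := isOpen_induced_iff.1 (isOpen_coinduced.1 hN)
  have hmem (A : Tuples E Z p) (ξ) (h : IsFrameOf A ξ) : A ∈ O ↔ ξ ∈ N := by
    obtain ⟨hA, rfl⟩ := h
    exact Set.ext_iff.1 hON ⟨A, hA⟩
  filter_upwards [hO.mem_nhds ((hmem _ _ hA₀).2 hξ₀)] with A hA ξ hξ
  exact (hmem A ξ hξ).1 hA

theorem HasSmoothFibrewiseRetraction.exists_frame_map (hρ : HasSmoothFibrewiseRetraction 𝒢)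
    (hξ₀ : ξ₀ ∈ 𝒢) (hA₀ : IsFrameOf A₀ ξ₀) :
    ∃ R : Tuples E Z p → Tuples E Z p,
      ContMDiffAt (𝓘(ℝ, E).prod 𝓘(ℝ, EuclideanSpace ℝ (Fin p) →L[ℝ] E))
        (𝓘(ℝ, E).prod 𝓘(ℝ, EuclideanSpace ℝ (Fin p) →L[ℝ] E)) ∞ R A₀ ∧
      ∀ᶠ A in 𝓝 A₀, ∀ ξ, IsFrameOf A ξ →
        ∃ ξ' ∈ 𝒢, ξ'.base = ξ.base ∧ IsFrameOf (R A) ξ' ∧ (ξ ∈ 𝒢 → ξ' = ξ) := by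
  obtain ⟨N, ρ, hN, h𝒢N, hρ𝒢, hρid, hρbase, hρsmooth⟩ := hρ
  obtain ⟨R, hR, hRρ⟩ := hρsmooth ξ₀ (h𝒢N hξ₀) A₀ hA₀
  refine ⟨R, hR, ?_⟩
  filter_upwards [hRρ, eventually_mem_of_isFrameOf hN (h𝒢N hξ₀) hA₀] with A hRA hAN ξ hξ
  exact ⟨ρ ξ, hρ𝒢 ξ (hAN ξ hξ), hρbase ξ (hAN ξ hξ), hRA ξ hξ, hρid ξ⟩

theorem HasSmoothFibrewiseRetraction.exists_frame_extension
    (hρ : HasSmoothFibrewiseRetraction 𝒢) (hχ : χ ∈ IsManifold.maximalAtlas 𝓘(ℝ, E) ∞ Z)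
    (hξ₀ : ξ₀ ∈ 𝒢) (hbase : ξ₀.base ∈ χ.source) {L : E → EuclideanSpace ℝ (Fin p) →L[ℝ] E}
    (hL : ContDiffAt ℝ ∞ L (χ ξ₀.base)) (hrange : chartPlane χ ξ₀ = (L (χ ξ₀.base)).range) :
    ∃ M : E → EuclideanSpace ℝ (Fin p) →L[ℝ] E, ContDiffAt ℝ ∞ M (χ ξ₀.base) ∧
      ∀ᶠ z in 𝓝 ξ₀.base, (∃ ξ ∈ 𝒢, ξ.base = z ∧ chartPlane χ ξ = (M (χ z)).range) ∧
        ∀ ξ ∈ 𝒢, ξ.base = z → chartPlane χ ξ = (L (χ z)).range →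
          (M (χ z)).range = (L (χ z)).range := by
  set B : E → Tuples E Z p := fun y => tupleOfChart χ y (L y)
  have hB := contMDiffAt_tupleOfChart hχ (χ.map_source hbase) hL
  have hBξ₀ : IsFrameOf (B (χ ξ₀.base)) ξ₀ :=
    (isFrameOf_tupleOfChart_iff hχ hbase).2 ⟨rfl, hrange⟩
  obtain ⟨R, hR, hR𝒢⟩ := hρ.exists_frame_map hξ₀ hBξ₀
  obtain ⟨ξ', -, hξ', hRξ', -⟩ := hR𝒢.self_of_nhds ξ₀ hBξ₀
  have hRbase : (R (B (χ ξ₀.base))).1 ∈ χ.source := (hRξ'.base_eq.trans hξ').symm ▸ hbase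
  refine ⟨fun y => chartTuple χ (R (B y)), contDiffAt_chartTuple hχ (hR.comp _ hB) hRbase, ?_⟩
  have hinj : ∀ᶠ y in 𝓝 (χ ξ₀.base), Function.Injective (L y) := by
    refine hL.continuousAt.eventually_mem (ContinuousLinearMap.isOpen_injective.mem_nhds ?_)
    obtain ⟨hA, -⟩ := hBξ₀
    exact Function.Injective.of_comp (f := modelDeriv E E χ.symm (χ ξ₀.base)) hA
  have hχcont := χ.continuousAt hbase
  filter_upwards [hχcont.eventually (hB.continuousAt.eventually hR𝒢), hχcont.eventually hinj,
    χ.open_source.mem_nhds hbase] with z hRz hLz hz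
  have hframe : IsFrame (B (χ z)) := (injective_modelDeriv_chart_symm hχ hz).comp hLz
  have hBplane : IsFrameOf (B (χ z)) (planeOf ⟨B (χ z), hframe⟩) := ⟨hframe, rfl⟩
  refine ⟨?_, fun ξ hξ hξz hξL => ?_⟩
  · obtain ⟨ξ', hξ'𝒢, hξ'base, hRξ', -⟩ := hRz _ hBplane
    exact ⟨ξ', hξ'𝒢, hξ'base.trans (χ.left_inv hz), hRξ'.range_chartTuple.symm⟩
  · obtain ⟨ξ', -, -, hRξ', hξ'⟩ := hRz ξ ((isFrameOf_tupleOfChart_iff hχ hz).2 ⟨hξz, hξL⟩)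
    rw [hRξ'.range_chartTuple, hξ' hξ, hξL]

end Extension

section SliceCharts

variable {F : Type*} [NormedAddCommGroup F] [NormedSpace ℝ F]
  {X : Type*} [TopologicalSpace X] [ChartedSpace F X]
  {E : Type*} [NormedAddCommGroup E] [NormedSpace ℝ E]
  {Z : Type*} [TopologicalSpace Z] [ChartedSpace E Z]
  {i : X → Z} {x x' : X}

variable (F E) in
/-- Charts `ψ` of `X` around `x` and `χ` of `Z` around `i x` in which `i : X → Z` is the linear
inclusion `J`, with a linear retraction `Q` of `J`. -/
structure SliceCharts (i : X → Z) (x : X) where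
  χ : OpenPartialHomeomorph Z E
  ψ : OpenPartialHomeomorph X F
  J : F →L[ℝ] E
  Q : E →L[ℝ] F
  χ_mem : χ ∈ IsManifold.maximalAtlas 𝓘(ℝ, E) ∞ Z
  ψ_mem : ψ ∈ IsManifold.maximalAtlas 𝓘(ℝ, F) ∞ X
  mem_source : x ∈ ψ.source
  map_mem_source : ∀ x' ∈ ψ.source, i x' ∈ χ.source
  χ_apply : ∀ x' ∈ ψ.source, χ (i x') = J (ψ x')
  Q_apply_J : Function.LeftInverse Q J

theorem nonempty_sliceCharts (hi : IsImmersionAt 𝓘(ℝ, F) 𝓘(ℝ, E) ∞ i x) :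
    Nonempty (SliceCharts F E i x) := by
  let J : F →L[ℝ] E :=
    (hi.equiv : (F × hi.complement) →L[ℝ] E) ∘L ContinuousLinearMap.inl ℝ F hi.complement
  let Q : E →L[ℝ] F :=
    ContinuousLinearMap.fst ℝ F hi.complement ∘L (hi.equiv.symm : E →L[ℝ] F × hi.complement)
  refine ⟨hi.codChart, hi.domChart, J, Q, hi.codChart_mem_maximalAtlas,
    hi.domChart_mem_maximalAtlas, hi.mem_domChart_source,
    fun _ hx' => hi.source_subset_preimage_source hx', fun x' hx' => ?_, fun v => by simp [J, Q]⟩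
  have hwritten := hi.writtenInCharts
    ((hi.domChart.extend 𝓘(ℝ, F)).map_source (x := x') (by simpa using hx'))
  simpa [hi.domChart.left_inv hx', J] using hwritten

namespace SliceCharts

variable (c : SliceCharts F E i x)

theorem modelDeriv_comp (hi : MDifferentiableAt 𝓘(ℝ, F) 𝓘(ℝ, E) i x') (hx' : x' ∈ c.ψ.source) :
    modelDeriv E E c.χ (i x') ∘L modelDeriv F E i x' = c.J ∘L modelDeriv F F c.ψ x' := by
  have heq : c.χ ∘ i =ᶠ[𝓝 x'] c.J ∘ c.ψ :=
    Filter.eventuallyEq_of_mem (c.ψ.open_source.mem_nhds hx') c.χ_apply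
  rw [← GeometricRestriction.modelDeriv_comp
    (mdifferentiableAt_chart c.χ_mem (c.map_mem_source x' hx')) hi, modelDeriv_congr heq,
    GeometricRestriction.modelDeriv_comp c.J.mdifferentiableAt
      (mdifferentiableAt_chart c.ψ_mem hx'), modelDeriv_eq_fderiv, ContinuousLinearMap.fderiv]

theorem injective_modelDeriv (hi : MDifferentiableAt 𝓘(ℝ, F) 𝓘(ℝ, E) i x')
    (hx' : x' ∈ c.ψ.source) : Function.Injective (modelDeriv F E i x') := by
  refine Function.Injective.of_comp (f := modelDeriv E E c.χ (i x')) ?_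
  rw [← ContinuousLinearMap.coe_comp, c.modelDeriv_comp hi hx']
  exact c.Q_apply_J.injective.comp (injective_modelDeriv_chart c.ψ_mem hx')

theorem eventually_exists_of_mem_range {P : X → Prop} (hP : ∀ᶠ x' in 𝓝 x, P x') :
    ∀ᶠ y in 𝓝 (c.χ (i x)), y ∈ c.J.range → ∃ x' ∈ c.ψ.source, c.χ (i x') = y ∧ P x' := by
  have hQ : Filter.Tendsto c.Q (𝓝 (c.χ (i x))) (𝓝 (c.ψ x)) := by
    have hQx : c.Q (c.χ (i x)) = c.ψ x := by rw [c.χ_apply x c.mem_source, c.Q_apply_J]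
    exact hQx ▸ c.Q.continuous.continuousAt
  have hψ := (c.ψ.tendsto_symm c.mem_source).comp hQ
  filter_upwards [hψ.eventually hP,
    hQ.eventually (c.ψ.open_target.mem_nhds (c.ψ.map_source c.mem_source))] with _ hPy hy
  rintro ⟨v, rfl⟩
  rw [ContinuousLinearMap.coe_coe, c.Q_apply_J] at hy
  have hv := c.ψ.map_target hy
  refine ⟨c.ψ.symm v, hv, by simp [c.χ_apply _ hv, c.ψ.right_inv hy], ?_⟩
  simpa [c.Q_apply_J v] using hPy

theorem exists_chartPlane_eq_map (hi : MDifferentiable 𝓘(ℝ, F) 𝓘(ℝ, E) i) {p : ℕ}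
    {𝒢 : Set (TangentPlane E Z p)} {ζ : TangentPlane F X p} (hζ : ζ ∈ tangentPlanes i 𝒢)
    (hbase : ζ.base ∈ c.ψ.source) :
    ∃ ξ ∈ 𝒢, ξ.base = i ζ.base ∧ chartPlane c.χ ξ = (chartPlane c.ψ ζ).map c.J.toLinearMap := by
  obtain ⟨_, hξ, _, rfl⟩ := hζ
  refine ⟨_, hξ, rfl, ?_⟩
  change (ζ.modelPlane.map (modelDeriv F E i ζ.base).toLinearMap).map
    (modelDeriv E E c.χ (i ζ.base)).toLinearMap = _
  rw [chartPlane, ← Submodule.map_comp, ← Submodule.map_comp]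
  exact congrArg (fun D : F →L[ℝ] E => ζ.modelPlane.map D.toLinearMap)
    (c.modelDeriv_comp (hi _) hbase)

end SliceCharts

end SliceCharts

section AdaptedFrames

variable {F : Type*} [NormedAddCommGroup F] [NormedSpace ℝ F]
  {X : Type*} [TopologicalSpace X] [ChartedSpace F X]
  {E : Type*} [NormedAddCommGroup E] [NormedSpace ℝ E]
  {Z : Type*} [TopologicalSpace Z] [ChartedSpace E Z]
  {i : X → Z} {x : X} {p : ℕ} {𝒢 : Set (TangentPlane E Z p)}

theorem span_range_clm_apply_single (L : EuclideanSpace ℝ (Fin p) →L[ℝ] E) :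
    Submodule.span ℝ (Set.range fun j => L (EuclideanSpace.single j 1)) = L.range := by
  have hbasis := (EuclideanSpace.basisFun (Fin p) ℝ).toBasis.span_eq
  have hmap := congrArg (Submodule.map L.toLinearMap) hbasis
  rw [Submodule.map_span, ← Set.range_comp, Submodule.map_top] at hmap
  rw [← hmap]
  congr 2
  ext j
  simp

namespace SliceCharts

/-- `β` is a `C¹` field of frames, in the chart `χ`, whose spans are planes of `𝒢` near `i x`, and
planes of `𝒢(TX)` at the points of `X` near `x`. -/
structure IsAdaptedFrame (c : SliceCharts F E i x) (𝒢 : Set (TangentPlane E Z p))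
    (β : E → Fin p → E) : Prop where
  contDiffAt : ContDiffAt ℝ 1 β (c.χ (i x))
  ambient : ∀ᶠ z in 𝓝 (i x), ∃ ξ ∈ 𝒢, ξ.base = z ∧
    chartPlane c.χ ξ = Submodule.span ℝ (Set.range (β (c.χ z)))
  tangent : ∀ᶠ x' in 𝓝 x, ∃ ζ ∈ tangentPlanes i 𝒢, ζ.base = x' ∧
    (chartPlane c.ψ ζ).map c.J.toLinearMap = Submodule.span ℝ (Set.range (β (c.χ (i x'))))

variable (c : SliceCharts F E i x)

theorem exists_tuples_of_smoothPlaneFieldAt [IsManifold 𝓘(ℝ, F) ∞ X] {η : X → TangentPlane F X p}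
    (hη : SmoothPlaneFieldAt η x) (hbase : (η x).base = x) :
    ∃ L : E → EuclideanSpace ℝ (Fin p) →L[ℝ] E, ContDiffAt ℝ ∞ L (c.χ (i x)) ∧
      ∀ᶠ x' in 𝓝 x, (L (c.χ (i x'))).range = (chartPlane c.ψ (η x')).map c.J.toLinearMap := by
  obtain ⟨A, hA, hAη⟩ := hη
  have hQ {x' : X} (hx' : x' ∈ c.ψ.source) : c.ψ.symm (c.Q (c.χ (i x'))) = x' := by
    rw [c.χ_apply x' hx', c.Q_apply_J, c.ψ.left_inv hx']
  have hQx : c.Q (c.χ (i x)) = c.ψ x := by rw [c.χ_apply x c.mem_source, c.Q_apply_J]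
  have hAQ : ContMDiffAt 𝓘(ℝ, E) (𝓘(ℝ, F).prod 𝓘(ℝ, EuclideanSpace ℝ (Fin p) →L[ℝ] F)) ∞
      (fun y => A (c.ψ.symm (c.Q y))) (c.χ (i x)) := by
    have hψ := hQx.symm ▸
      contMDiffAt_symm_of_mem_maximalAtlas c.ψ_mem (c.ψ.map_source c.mem_source)
    exact ContMDiffAt.comp _ ((hQ c.mem_source).symm ▸ hA)
      (hψ.comp _ c.Q.contDiff.contDiffAt.contMDiffAt)
  have hsource : (A (c.ψ.symm (c.Q (c.χ (i x))))).1 ∈ c.ψ.source := by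
    rw [hQ c.mem_source, hAη.self_of_nhds.base_eq, hbase]
    exact c.mem_source
  refine ⟨fun y => c.J ∘L chartTuple c.ψ (A (c.ψ.symm (c.Q y))),
    contDiffAt_const.clm_comp (contDiffAt_chartTuple c.ψ_mem hAQ hsource), ?_⟩
  filter_upwards [hAη, c.ψ.open_source.mem_nhds c.mem_source] with x' hAx' hx'
  rw [hQ hx', ← hAx'.range_chartTuple]
  exact LinearMap.range_comp _ _

theorem modelDeriv_mem_span {ζ : TangentPlane F X p} {e : Fin p → F} {β : E → Fin p → E}
    (hi : MDifferentiableAt 𝓘(ℝ, F) 𝓘(ℝ, E) i ζ.base)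
    (hζ : ζ.base ∈ c.ψ.source)
    (hβ : (chartPlane c.ψ ζ).map c.J.toLinearMap =
      Submodule.span ℝ (Set.range (β (c.χ (i ζ.base)))))
    (he : Submodule.span ℝ (Set.range e) = ζ.modelPlane) (j : Fin p) :
    modelDeriv E E c.χ (i ζ.base) (modelDeriv F E i ζ.base (e j)) ∈
      Submodule.span ℝ (Set.range (β (c.χ (i ζ.base)))) := by
  have hD := DFunLike.congr_fun (c.modelDeriv_comp hi hζ) (e j)
  have hj : e j ∈ ζ.modelPlane := he ▸ Submodule.subset_span ⟨j, rfl⟩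
  rw [← hβ]
  exact hD ▸ Submodule.mem_map_of_mem (Submodule.mem_map_of_mem hj)

theorem IsAdaptedFrame.eventually_mem_range {c : SliceCharts F E i x} {β : E → Fin p → E}
    (hβ : c.IsAdaptedFrame 𝒢 β) :
    ∀ᶠ y in 𝓝 (c.χ (i x)), y ∈ c.J.range → ∀ j, β y j ∈ c.J.range := by
  filter_upwards [c.eventually_exists_of_mem_range hβ.tangent] with y hy hyJ j
  obtain ⟨x', -, rfl, ζ, -, -, hplane⟩ := hy hyJ
  have hj : β (c.χ (i x')) j ∈ (chartPlane c.ψ ζ).map c.J.toLinearMap :=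
    hplane ▸ Submodule.subset_span ⟨j, rfl⟩
  exact LinearMap.map_le_range hj

variable [IsManifold 𝓘(ℝ, E) ∞ Z]

theorem exists_isAdaptedFrame [IsManifold 𝓘(ℝ, F) ∞ X] (hi : ContMDiff 𝓘(ℝ, F) 𝓘(ℝ, E) ∞ i)
    (hρ : HasSmoothFibrewiseRetraction 𝒢) (hreg : IsRegular (F := F) i 𝒢)
    {ζ₀ : TangentPlane F X p} (hζ₀ : ζ₀ ∈ tangentPlanes i 𝒢) (c : SliceCharts F E i ζ₀.base) :
    ∃ β : E → Fin p → E, c.IsAdaptedFrame 𝒢 β ∧ (chartPlane c.ψ ζ₀).map c.J.toLinearMap =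
      Submodule.span ℝ (Set.range (β (c.χ (i ζ₀.base)))) := by
  obtain ⟨U, η, hU, hxU, hη₀, hη⟩ := hreg ζ₀ hζ₀
  have hi' := hi.mdifferentiable (by simp)
  obtain ⟨L, hL, hLη⟩ := c.exists_tuples_of_smoothPlaneFieldAt (hη _ hxU).2.2 (hη _ hxU).1
  have hLζ₀ := hη₀ ▸ hLη.self_of_nhds
  obtain ⟨ξ₀, hξ₀, hbase, hplane⟩ := c.exists_chartPlane_eq_map hi' hζ₀ c.mem_source
  obtain ⟨M, hM, hM𝒢⟩ := hρ.exists_frame_extension c.χ_mem hξ₀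
    (hbase ▸ c.map_mem_source _ c.mem_source) (hbase ▸ hL) (hbase ▸ hplane.trans hLζ₀.symm)
  rw [hbase] at hM hM𝒢
  have hMη : ∀ᶠ x in 𝓝 ζ₀.base, (chartPlane c.ψ (η x)).map c.J.toLinearMap =
      (M (c.χ (i x))).range := by
    filter_upwards [hi.continuous.continuousAt.eventually hM𝒢, hLη, hU.mem_nhds hxU,
      c.ψ.open_source.mem_nhds c.mem_source] with x ⟨_, hMx⟩ hLx hx hxψ
    obtain ⟨hηbase, hη𝒢, -⟩ := hη x hx
    obtain ⟨ξ, hξ, hξbase, hξplane⟩ := c.exists_chartPlane_eq_map hi' hη𝒢 (hηbase.symm ▸ hxψ)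
    rw [hMx ξ hξ (hξbase.trans (congrArg i hηbase)) (hξplane.trans hLx.symm), hLx]
  refine ⟨fun y j => M y (EuclideanSpace.single j 1), ⟨?_, ?_, ?_⟩, ?_⟩
  · exact contDiffAt_pi.2 fun j => (hM.of_le (by simp)).clm_apply contDiffAt_const
  · simpa only [span_range_clm_apply_single] using hM𝒢.mono fun _ => And.left
  · simp only [span_range_clm_apply_single]
    filter_upwards [hMη, hU.mem_nhds hxU] with x hMx hx
    exact ⟨η x, (hη x hx).2.1, (hη x hx).1, hMx⟩
  · rw [span_range_clm_apply_single, ← hMη.self_of_nhds, hη₀]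

end SliceCharts

end AdaptedFrames

section Traces

variable {E : Type*} [NormedAddCommGroup E] [NormedSpace ℝ E]
  {Z : Type*} [TopologicalSpace Z] [ChartedSpace E Z]
  {χ : OpenPartialHomeomorph Z E} {p : ℕ} {𝒢 : Set (TangentPlane E Z p)}

theorem hessian_congr (g : BilinearField E Z) {φ φ' : Z → ℝ} {z : Z} (hφ : φ =ᶠ[𝓝 z] φ')
    (v w : E) : hessian g φ z v w = hessian g φ' z v w := by
  have hz := mem_chart_source E z
  have hφ' : φ ∘ (chartAt E z).symm =ᶠ[𝓝 (chartAt E z z)] φ' ∘ (chartAt E z).symm :=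
    ((chartAt E z).tendsto_symm hz).eventually hφ
  rw [hessian_eq_localHessian_chartAt, hessian_eq_localHessian_chartAt, localHessian_congr hφ']

theorem hessian_zero (g : BilinearField E Z) (z : Z) (v w : E) :
    hessian g (0 : Z → ℝ) z v w = 0 := by
  rw [hessian_eq_localHessian_chartAt, localHessian_apply, Pi.zero_comp]
  simp

theorem localMetric_chart_apply (g : BilinearField E Z)
    (hχ : χ ∈ IsManifold.maximalAtlas 𝓘(ℝ, E) ∞ Z) {z : Z} (hz : z ∈ χ.source) (v w : E) :
    localMetric g χ.symm (χ z) (modelDeriv E E χ z v) (modelDeriv E E χ z w) =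
      modelForm g z v w := by
  have hD (v : E) : modelDeriv E E χ.symm (χ z) (modelDeriv E E χ z v) = v :=
    DFunLike.congr_fun (modelDeriv_symm_comp_chart hχ hz) v
  rw [localMetric_eq_bilinearComp, ContinuousLinearMap.bilinearComp_apply, hD, hD, χ.left_inv hz]

variable [FiniteDimensional ℝ E] [IsManifold 𝓘(ℝ, E) ∞ Z]
  (g : ContMDiffRiemannianMetric 𝓘(ℝ, E) ∞ E (fun z : Z => TangentSpace 𝓘(ℝ, E) z))

theorem sum_hessian_comp_chart (hχ : χ ∈ IsManifold.maximalAtlas 𝓘(ℝ, E) ∞ Z) {z : Z}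
    (hz : z ∈ χ.source) {f : E → ℝ} (hf : ContDiffAt ℝ 2 f (χ z)) {ι : Type*} [Fintype ι]
    [DecidableEq ι] {e : ι → E}
    (he : ∀ j k, modelForm g.inner z (e j) (e k) = if j = k then 1 else 0)
    {β : E → ι → E}
    (hβ : ∀ j, modelDeriv E E χ z (e j) ∈ Submodule.span ℝ (Set.range (β (χ z)))) :
    ∑ j, hessian g.inner (f ∘ χ) z (e j) (e j) =
      hessianTrace (localMetric g.inner χ.symm) β f (χ z) := by
  rw [hessianTrace,
    ← sum_eq_formTrace (fun j k => (localMetric_chart_apply g.inner hχ hz _ _).trans (he j k)) hβ]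
  exact Finset.sum_congr rfl fun j _ => hessian_comp_chart g hχ hz hf _ _

theorem IsPlurisubharmonic.frameSubharmonicAt {u : Z → EReal}
    (hu : IsPlurisubharmonic g.inner 𝒢 u) (hχ : χ ∈ IsManifold.maximalAtlas 𝓘(ℝ, E) ∞ Z)
    {ξ : TangentPlane E Z p} (hξ : ξ ∈ 𝒢) (hz : ξ.base ∈ χ.source) {β : E → Fin p → E}
    (hβ : chartPlane χ ξ = Submodule.span ℝ (Set.range (β (χ ξ.base)))) :
    FrameSubharmonicAt (localMetric g.inner χ.symm) β (u ∘ χ.symm) (χ ξ.base) := by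
  intro f hf hle heq
  obtain ⟨e, he, hspan⟩ := (isInnerProduct_modelForm g ξ.base).exists_orthonormal ξ.modelPlane
    ξ.finrank_eq
  have htest : IsTestFunction (E := E) u ξ.base (f ∘ χ) := by
    refine ⟨hf.contMDiffAt.comp _
      ((contMDiffAt_of_mem_maximalAtlas hχ hz).of_le ENat.LEInfty.out), ?_, ?_⟩
    · filter_upwards [(χ.continuousAt hz).eventually hle, χ.open_source.mem_nhds hz] with z hle hz
      simpa only [Function.comp_apply, χ.left_inv hz] using hle
    · simpa only [Function.comp_apply, χ.left_inv hz] using heq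
  have hmem (j : Fin p) :
      modelDeriv E E χ ξ.base (e j) ∈ Submodule.span ℝ (Set.range (β (χ ξ.base))) :=
    hβ ▸ Submodule.mem_map_of_mem (hspan ▸ Submodule.subset_span ⟨j, rfl⟩)
  exact (hu.2.2 ξ hξ _ htest e ⟨he, hspan⟩).trans_eq (sum_hessian_comp_chart g hχ hz hf he hmem)

end Traces

namespace SliceCharts

section Restriction

variable {F : Type*} [NormedAddCommGroup F] [NormedSpace ℝ F]
  {X : Type*} [TopologicalSpace X] [ChartedSpace F X]
  {E : Type*} [NormedAddCommGroup E] [NormedSpace ℝ E]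
  {Z : Type*} [TopologicalSpace Z] [ChartedSpace E Z]
  {i : X → Z} {x : X} {c : SliceCharts F E i x} {p : ℕ} {𝒢 : Set (TangentPlane E Z p)}
  {ζ : TangentPlane F X p} {e : Fin p → F} {β : E → Fin p → E}

theorem exists_contDiffAt_extension (c : SliceCharts F E i x) {u : Z → EReal} {φ : X → ℝ}
    (hφ : IsTestFunction (E := F) (u ∘ i) x φ) :
    ∃ f : E → ℝ, ContDiffAt ℝ 2 f (c.χ (i x)) ∧ φ =ᶠ[𝓝 x] f ∘ c.J ∘ c.ψ ∧
      (∀ᶠ y in 𝓝 (c.χ (i x)), y ∈ c.J.range → (u ∘ c.χ.symm) y ≤ f y) ∧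
      (u ∘ c.χ.symm) (c.χ (i x)) = f (c.χ (i x)) := by
  obtain ⟨hφ, hle, heq⟩ := hφ
  have hf {x' : X} (hx' : x' ∈ c.ψ.source) : φ (c.ψ.symm (c.Q (c.χ (i x')))) = φ x' := by
    rw [c.χ_apply x' hx', c.Q_apply_J, c.ψ.left_inv hx']
  have hu {x' : X} (hx' : x' ∈ c.ψ.source) : u (c.χ.symm (c.χ (i x'))) = u (i x') := by
    rw [c.χ.left_inv (c.map_mem_source x' hx')]
  have hQx : c.Q (c.χ (i x)) = c.ψ x := by rw [c.χ_apply x c.mem_source, c.Q_apply_J]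
  refine ⟨(φ ∘ c.ψ.symm) ∘ c.Q, ?_, ?_, ?_, ?_⟩
  · exact ContDiffAt.comp _ (hQx ▸ contDiffAt_comp_chart_symm c.ψ_mem c.mem_source hφ)
      c.Q.contDiff.contDiffAt
  · filter_upwards [c.ψ.open_source.mem_nhds c.mem_source] with x' hx'
    simp only [Function.comp_apply, ← c.χ_apply x' hx', hf hx']
  · filter_upwards [c.eventually_exists_of_mem_range hle] with y hy hyJ
    obtain ⟨x', hx', rfl, hle⟩ := hy hyJ
    simpa only [Function.comp_apply, hf hx', hu hx'] using hle
  · simpa only [Function.comp_apply, hf c.mem_source, hu c.mem_source] using heq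

variable [IsManifold 𝓘(ℝ, E) ∞ Z]
  (g : ContMDiffRiemannianMetric 𝓘(ℝ, E) ∞ E (fun z : Z => TangentSpace 𝓘(ℝ, E) z))

theorem isUnit_det_formMatrix (hi : MDifferentiableAt 𝓘(ℝ, F) 𝓘(ℝ, E) i ζ.base)
    (hζ : ζ.base ∈ c.ψ.source)
    (hβ : (chartPlane c.ψ ζ).map c.J.toLinearMap =
      Submodule.span ℝ (Set.range (β (c.χ (i ζ.base)))))
    (he : IsOrthonormalBasisOf (pullbackMetric (F := F) i g.inner) ζ e) :
    IsUnit (formMatrix (localMetric g.inner c.χ.symm (c.χ (i ζ.base)))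
      (β (c.χ (i ζ.base)))).det :=
  GeometricRestriction.isUnit_det_formMatrix
    (fun j k => (localMetric_chart_apply g.inner c.χ_mem (c.map_mem_source _ hζ) _ _).trans
      (he.1 j k)) (c.modelDeriv_mem_span hi hζ hβ he.2)

variable [FiniteDimensional ℝ E]

theorem IsAdaptedFrame.eventually_frameSubharmonicAt (hβ : c.IsAdaptedFrame 𝒢 β)
    {u : Z → EReal} (hu : IsPlurisubharmonic g.inner 𝒢 u) :
    ∀ᶠ y in 𝓝 (c.χ (i x)),
      FrameSubharmonicAt (localMetric g.inner c.χ.symm) β (u ∘ c.χ.symm) y := by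
  have hix := c.map_mem_source x c.mem_source
  refine (c.χ.eventually_nhds _ hix).2 ?_
  filter_upwards [hβ.ambient, c.χ.open_source.mem_nhds hix] with z ⟨ξ, hξ, hbase, hplane⟩ hz
  subst hbase
  exact hu.frameSubharmonicAt g c.χ_mem hξ hz hplane

variable [FiniteDimensional ℝ F] [IsManifold 𝓘(ℝ, F) ∞ X]

theorem sum_hessian_pullbackMetric (c : SliceCharts F E i x)
    (hi : ContMDiff 𝓘(ℝ, F) 𝓘(ℝ, E) ∞ i)
    (hζ : ζ.base ∈ c.ψ.source)
    (hβ : (chartPlane c.ψ ζ).map c.J.toLinearMap =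
      Submodule.span ℝ (Set.range (β (c.χ (i ζ.base)))))
    (he : IsOrthonormalBasisOf (pullbackMetric (F := F) i g.inner) ζ e)
    (hB : ∑ j, secondFundamentalForm (F := F) g.inner i ζ.base (e j) (e j) = 0)
    {f : E → ℝ} (hf : ContDiffAt ℝ 2 f (c.χ (i ζ.base))) {φ : X → ℝ}
    (hφ : φ =ᶠ[𝓝 ζ.base] f ∘ c.J ∘ c.ψ) :
    ∑ j, hessian (pullbackMetric (F := F) i g.inner) φ ζ.base (e j) (e j) =
      hessianTrace (localMetric g.inner c.χ.symm) β f (c.χ (i ζ.base)) := by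
  have hi' := hi.mdifferentiable (by simp) ζ.base
  have hiζ := c.map_mem_source _ hζ
  have hφ' : φ =ᶠ[𝓝 ζ.base] (f ∘ c.χ) ∘ i := by
    filter_upwards [hφ, c.ψ.open_source.mem_nhds hζ] with x' hx' hx'ψ
    rw [hx', Function.comp_apply, Function.comp_apply, ← c.χ_apply x' hx'ψ]
    rfl
  have hfχ : ContMDiffAt 𝓘(ℝ, E) 𝓘(ℝ, ℝ) 2 (f ∘ c.χ) (i ζ.base) :=
    hf.contMDiffAt.comp _ ((contMDiffAt_of_mem_maximalAtlas c.χ_mem hiζ).of_le ENat.LEInfty.out)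
  calc ∑ j, hessian (pullbackMetric (F := F) i g.inner) φ ζ.base (e j) (e j)
    _ = ∑ j, hessian (pullbackMetric (F := F) i g.inner) ((f ∘ c.χ) ∘ i) ζ.base (e j) (e j) :=
      Finset.sum_congr rfl fun j _ => hessian_congr _ hφ' _ _
    _ = ∑ j, hessian g.inner (f ∘ c.χ) (i ζ.base) (modelDeriv F E i ζ.base (e j))
          (modelDeriv F E i ζ.base (e j)) :=
      sum_hessian_comp g hi (c.injective_modelDeriv hi' hζ) hB hfχ
    _ = hessianTrace (localMetric g.inner c.χ.symm) β f (c.χ (i ζ.base)) :=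
      sum_hessian_comp_chart g c.χ_mem hiζ hf he.1 (c.modelDeriv_mem_span hi' hζ hβ he.2)

theorem IsAdaptedFrame.eventually_hessianTrace_eq_zero (hβ : c.IsAdaptedFrame 𝒢 β)
    (hi : ContMDiff 𝓘(ℝ, F) 𝓘(ℝ, E) ∞ i) (hflat : IsFlat (F := F) g.inner i 𝒢) :
    ∀ᶠ y in 𝓝 (c.χ (i x)), y ∈ c.J.range → ∀ ℓ : E →L[ℝ] ℝ, (∀ v ∈ c.J.range, ℓ v = 0) →
      hessianTrace (localMetric g.inner c.χ.symm) β ℓ y = 0 := by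
  filter_upwards [c.eventually_exists_of_mem_range hβ.tangent] with y hy hyJ ℓ hℓ
  obtain ⟨_, hζψ, rfl, ζ, hζ, rfl, hplane⟩ := hy hyJ
  have hinj := c.injective_modelDeriv (hi.mdifferentiable (by simp) _) hζψ
  obtain ⟨e, he⟩ : ∃ e, IsOrthonormalBasisOf (pullbackMetric (F := F) i g.inner) ζ e :=
    ((isInnerProduct_modelForm g (i ζ.base)).bilinearComp hinj).exists_orthonormal ζ.modelPlane
      ζ.finrank_eq
  have hℓJ : 0 = ℓ ∘ c.J ∘ c.ψ := funext fun x' => (hℓ _ ⟨c.ψ x', rfl⟩).symm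
  rw [← c.sum_hessian_pullbackMetric g hi hζψ hplane he (hflat.2 ζ hζ e he)
    ℓ.contDiff.contDiffAt (.of_eq hℓJ)]
  exact Finset.sum_eq_zero fun j _ => hessian_zero _ _ _ _

end Restriction

end SliceCharts

end GeometricRestriction

open GeometricRestriction in
theorem theorem8p2_general
    {E : Type*} [NormedAddCommGroup E] [NormedSpace ℝ E] [FiniteDimensional ℝ E]
    {Z : Type*} [TopologicalSpace Z] [ChartedSpace E Z] [IsManifold 𝓘(ℝ, E) ∞ Z]
    {F : Type*} [NormedAddCommGroup F] [NormedSpace ℝ F]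
    {X : Type*} [TopologicalSpace X] [ChartedSpace F X] [IsManifold 𝓘(ℝ, F) ∞ X]
    (g : ContMDiffRiemannianMetric 𝓘(ℝ, E) ∞ E (fun z : Z => TangentSpace 𝓘(ℝ, E) z))
    (p : ℕ) (𝒢 : Set (TangentPlane E Z p))
    (hρ : HasSmoothFibrewiseRetraction 𝒢)
    (i : X → Z) (hi : IsImmersion 𝓘(ℝ, F) 𝓘(ℝ, E) ∞ i)
    (hflat : IsFlat (F := F) g.inner i 𝒢)
    (u : Z → EReal) (hu : IsPlurisubharmonic g.inner 𝒢 u) :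
    IsPlurisubharmonic
      (pullbackMetric (F := F) i g.inner)
      (tangentPlanes (F := F) i 𝒢) (u ∘ i) := by
  have hi' := hi.contMDiff
  refine ⟨hu.1.comp hi'.continuous, fun x => hu.2.1 (i x), fun ζ hζ φ hφ e he => ?_⟩
  obtain ⟨c⟩ := nonempty_sliceCharts (hi.isImmersionAt ζ.base)
  have : FiniteDimensional ℝ F := .of_injective c.J.toLinearMap c.Q_apply_J.injective
  have hiζ := c.map_mem_source _ c.mem_source
  obtain ⟨β, hβ, hplane⟩ := SliceCharts.exists_isAdaptedFrame hi' hρ hflat.1 hζ c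
  obtain ⟨f, hf, hφf, hle, heq⟩ := c.exists_contDiffAt_extension hφ
  have husc : ∀ᶠ y in 𝓝 (c.χ (i ζ.base)), UpperSemicontinuousAt (u ∘ c.χ.symm) y :=
    (c.χ.open_target.eventually_mem (c.χ.map_source hiζ)).mono fun y hy =>
      (hu.1 _).comp (c.χ.continuousAt_symm hy)
  rw [c.sum_hessian_pullbackMetric g hi' c.mem_source hplane he (hflat.2 ζ hζ e he) hf hφf]
  exact hessianTrace_nonneg_of_le (S := c.J.range)
    ((contDiffAt_localMetric_chart g c.χ_mem hiζ).of_le ENat.LEInfty.out)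
    (isInnerProduct_localMetric_chart g c.χ_mem hiζ).isInvertible hβ.contDiffAt
    (SliceCharts.isUnit_det_formMatrix g (hi'.mdifferentiable (by simp) _) c.mem_source hplane he)
    ⟨c.ψ ζ.base, (c.χ_apply _ c.mem_source).symm⟩ hβ.eventually_mem_range
    (hβ.eventually_hessianTrace_eq_zero g hi' hflat) husc (.of_forall fun _ => hu.2.1 _)
    (hβ.eventually_frameSubharmonicAt g hu) hf hle heq

end

theorem theorem8p2
    {E : Type*} [NormedAddCommGroup E] [NormedSpace ℝ E] [FiniteDimensional ℝ E]
    {Z : Type*} [TopologicalSpace Z] [ChartedSpace E Z] [IsManifold 𝓘(ℝ, E) ∞ Z]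
    {F : Type*} [NormedAddCommGroup F] [NormedSpace ℝ F] [FiniteDimensional ℝ F]
    {X : Type*} [TopologicalSpace X] [ChartedSpace F X] [IsManifold 𝓘(ℝ, F) ∞ X]
    (g : ContMDiffRiemannianMetric 𝓘(ℝ, E) ∞ E (fun z : Z => TangentSpace 𝓘(ℝ, E) z))
    (p : ℕ) (𝒢 : Set (GeometricRestriction.TangentPlane E Z p))
    (h𝒢 : IsClosed 𝒢) (hρ : GeometricRestriction.HasSmoothFibrewiseRetraction 𝒢)
    (i : X → Z) (hi : IsImmersion 𝓘(ℝ, F) 𝓘(ℝ, E) ∞ i) (hinj : Function.Injective i)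
    (hdim : p ≤ Module.finrank ℝ F)
    (hflat : GeometricRestriction.IsFlat (F := F) g.inner i 𝒢)
    (u : Z → EReal) (hu : GeometricRestriction.IsPlurisubharmonic g.inner 𝒢 u) :
    GeometricRestriction.IsPlurisubharmonic
      (GeometricRestriction.pullbackMetric (F := F) i g.inner)
      (GeometricRestriction.tangentPlanes (F := F) i 𝒢) (u ∘ i) := by
  exact theorem8p2_general g p 𝒢 hρ i hi hflat u hu
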